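/- Let \(G=(V,E)\) be a finite simple graph with vertex capacities \(b:V\to\mathbb Z_{\ge 0}\) and edge weights \(w:E\to\mathbb R\), and let \(\delta(v)\) be the set of edges incident to \(v\). A fractional \(b\)-matching is a vector \(x\in\mathbb R_{\ge0}^E\) with \(\sum_{e\in\delta(v)}x_e\le b_v\) for all \(v\in V\); it is a \(b\)-matching if it is integral, and maximum if it maximizes \(\sum_{e\in E} w_ex_e\) among the fractional \(b\)-matchings. A fractional \(w\)-cover is a vector \(y\in\mathbb R_{\ge0}^V\) with \(y_i+y_j\ge w_{ij}\) for all \(ij\in E\); it is minimum if it minimizes \(\sum_{i\in V}b_iy_i\). For \(S\subseteq V\), let \(\gamma(S)\) be the maximum weight of a \(b\)-matching in the induced subgraph \(G[S]\); this defines the multiple partners matching (\(b\)-matching) game on \(G\). For \(0<\alpha\le1\), a vector \(a\in\mathbb R_{\ge0}^V\) lies in the \(\alpha\)-approximate core of this game if \(\sum_{i\in V}a_i\le\gamma(V)\) and \(\sum_{i\in S}a_i\ge\alpha\,\gamma(S)\) for all \(S\subseteq V\). Mechanism. (1) Take a half-integral maximum fractional \(b\)-matching \(x\) (that is, \(2x\)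 is integral) and a minimum fractional \(w\)-cover \(y\). (2) Modify \(x\), keeping it a half-integral maximum fractional \(b\)-matching, so that its non-integral edges form a family \(\mathcal C\) of vertex-disjoint odd cycles. (3) Output the vector \(a\) with \(a_i=\bigl(1-\tfrac1{l_C b_i}\bigr)b_iy_i\) if \(i\) lies on a cycle \(C\in\mathcal C\) of length \(l_C\), and \(a_i=b_iy_i\) if \(i\) lies on no cycle of \(\mathcal C\). Then the following hold. (i) A half-integral maximum fractional \(b\)-matching and a minimum fractional \(w\)-cover exist. (ii) Every half-integral maximum fractional \(b\)-matching can be modified as in (2) by a finite sequence of operations of the following kind: choose a trail in the graph formed by the current non-integral edges that either joins two distinct vertices of odd degree in that graph or is closed of even length, and change the values along its successive edges alternately by \(-\tfrac12,+\tfrac12,-\tfrac12,\dots\). (iii) For every \(x\) and \(\mathcal C\) that can result from (2), and every minimum fractional \(w\)-cover \(y\), the output \(a\) lies in the \(\bigl(1-\tfrac1{l'b'}\bigr)\)-approximate core of the game, where \(l'=\min_{C\in\mathcal C}l_C\) and \(b'=\min_{C\in\mathcal C}\min_{v\in C}b_v\). (iv) If moreover \(b_v\ge1\) for all \(v\in V\),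 then every such \(a\) lies in the \(\bigl(1-\tfrac1{l_{\min}b_{\min}}\bigr)\)-approximate core of the game, where \(l_{\min}\) is the minimum length of an odd cycle of \(G\) and \(b_{\min}=\min_{v\in V}b_v\). Here a minimum over the empty set is \(\infty\) and \(1/\infty=0\), so the factor is \(1\) when \(\mathcal C\) is empty, respectively when \(G\) has no odd cycle. -/

import Mathlib

open scoped ENNReal

namespace BMatchingGame

variable {V : Type*} [Fintype V]

/-! Vectors indexed by the edges of a graph `H` on `V` are represented by functions on `Sym2 V`;
values at elements of `Sym2 V` that are not edges of `H` are never used. -/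

open scoped Classical in
/-- The weight `w(H, x) = ∑_{e ∈ E(H)} w_e x_e`. -/
noncomputable def weight (H : SimpleGraph V) (w x : Sym2 V → ℝ) : ℝ :=
  ∑ e ∈ H.edgeFinset, w e * x e

open scoped Classical in
/-- The load `∑_{e ∈ δ(v)} x_e` of a vertex `v`. -/
noncomputable def load (H : SimpleGraph V) (x : Sym2 V → ℝ) (v : V) : ℝ :=
  ∑ e ∈ H.edgeFinset with v ∈ e, x e

/-- Fractional `b`-matchings of `H`: the feasible solutions of the primal linear program. -/
def IsFractionalBMatching (H : SimpleGraph V) (b : V → ℕ) (x : Sym2 V → ℝ) : Prop :=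
  (∀ v, load H x v ≤ b v) ∧ ∀ e ∈ H.edgeSet, 0 ≤ x e

/-- (Integral) `b`-matchings of `H`. -/
def IsBMatching (H : SimpleGraph V) (b : V → ℕ) (z : Sym2 V → ℤ) : Prop :=
  IsFractionalBMatching H b (fun e => (z e : ℝ))

/-- Maximum fractional `b`-matchings: the optimal solutions of the primal linear program. -/
def IsMaxFractionalBMatching (H : SimpleGraph V) (b : V → ℕ) (w x : Sym2 V → ℝ) : Prop :=
  IsFractionalBMatching H b x ∧
    ∀ x' : Sym2 V → ℝ, IsFractionalBMatching H b x' → weight H w x' ≤ weight H w x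

/-- Fractional `w`-covers of `H`: the feasible solutions of the dual linear program. -/
def IsFractionalCover (H : SimpleGraph V) (w : Sym2 V → ℝ) (y : V → ℝ) : Prop :=
  (∀ i j, H.Adj i j → w s(i, j) ≤ y i + y j) ∧ ∀ i, 0 ≤ y i

/-- Minimum fractional `w`-covers: the optimal solutions of the dual linear program. -/
def IsMinFractionalCover (H : SimpleGraph V) (b : V → ℕ) (w : Sym2 V → ℝ) (y : V → ℝ) : Prop :=
  IsFractionalCover H w y ∧
    ∀ y' : V → ℝ, IsFractionalCover H w y' → ∑ i, (b i : ℝ) * y i ≤ ∑ i, (b i : ℝ) * y' i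

/-! ### The game -/

/-- The induced subgraph `G[S]`, kept on the vertex type `V`: the vertices outside `S` become
isolated, which affects neither the `b`-matchings nor their weights. -/
def inducedSubgraph (G : SimpleGraph V) (S : Set V) : SimpleGraph V where
  Adj u v := G.Adj u v ∧ u ∈ S ∧ v ∈ S
  symm := ⟨fun _ _ h => ⟨h.1.symm, h.2.2, h.2.1⟩⟩
  loopless := ⟨fun _ h => h.1.ne rfl⟩

/-- The set of weights of the `b`-matchings of `H`. -/
def matchingWeights (H : SimpleGraph V) (b : V → ℕ) (w : Sym2 V → ℝ) : Set ℝ :=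
  {r | ∃ z : Sym2 V → ℤ, IsBMatching H b z ∧ weight H w (fun e => (z e : ℝ)) = r}

/-- The characteristic function `γ` of the `b`-matching game: `γ(S)` is the weight of a maximum
`b`-matching in `G[S]` (the supremum is a maximum, see `gamma_isGreatest`). -/
noncomputable def gamma (G : SimpleGraph V) (b : V → ℕ) (w : Sym2 V → ℝ) (S : Set V) : ℝ :=
  sSup (matchingWeights (inducedSubgraph G S) b w)

/-- A vector `a` is an allocation in the `α`-approximate core (`0 < α ≤ 1`) of the `b`-matching
game on `G`. -/
structure InApproxCore (G : SimpleGraph V) (b : V → ℕ) (w : Sym2 V → ℝ) (α : ℝ) (a : V → ℝ) :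
    Prop where
  factor_pos : 0 < α
  factor_le_one : α ≤ 1
  nonneg : ∀ i, 0 ≤ a i
  grand : ∑ i, a i ≤ gamma G b w Set.univ
  coalition : ∀ S : Finset V, α * gamma G b w S ≤ ∑ i ∈ S, a i

/-! ### Odd cycles and non-integral edges -/

/-- A subgraph of `G` is an odd cycle. -/
def IsOddCycle {G : SimpleGraph V} (C : G.Subgraph) : Prop :=
  ∃ (v : V) (p : G.Walk v v), p.IsCycle ∧ Odd p.length ∧ C = p.toSubgraph

/-- The length of a cycle: its number of edges. -/
noncomputable def cycleLength {G : SimpleGraph V} (C : G.Subgraph) : ℕ := C.edgeSet.ncard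

/-- A real number is integral. -/
def IsInteger (r : ℝ) : Prop := ∃ n : ℤ, r = n

/-- An edge vector `x` is half-integral: `2x` is integral. -/
def IsHalfIntegral (G : SimpleGraph V) (x : Sym2 V → ℝ) : Prop :=
  ∀ e ∈ G.edgeSet, IsInteger (2 * x e)

/-- The subgraph `G'` formed by the non-integral edges of `x`. -/
def nonIntegralGraph (G : SimpleGraph V) (x : Sym2 V → ℝ) : SimpleGraph V where
  Adj u v := G.Adj u v ∧ ¬ IsInteger (x s(u, v))
  symm := ⟨fun u v h => ⟨h.1.symm, by rw [Sym2.eq_swap]; exact h.2⟩⟩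
  loopless := ⟨fun _ h => h.1.ne rfl⟩

/-- The non-integral edges of `x` form vertex-disjoint odd cycles, namely those in `𝒞`. -/
structure NonIntegralCycles (G : SimpleGraph V) (x : Sym2 V → ℝ) (𝒞 : Set G.Subgraph) :
    Prop where
  oddCycle : ∀ C ∈ 𝒞, IsOddCycle C
  disjoint : ∀ C ∈ 𝒞, ∀ D ∈ 𝒞, C ≠ D → Disjoint C.verts D.verts
  edges : ∀ e ∈ G.edgeSet, ¬ IsInteger (x e) ↔ ∃ C ∈ 𝒞, e ∈ C.edgeSet

/-! ### The mechanism -/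

open scoped Classical in
/-- The result of changing `x` alternately by `-1/2, +1/2, -1/2, …` along the edges
`e₁, e₂, e₃, …` of a list without repetition. -/
noncomputable def alternate (x : Sym2 V → ℝ) (T : List (Sym2 V)) (e : Sym2 V) : ℝ :=
  if e ∈ T then (if Even (T.idxOf e) then x e - 1 / 2 else x e + 1 / 2) else x e

/-- One modification step: `x'` arises from `x` by the alternating operation along a trail of
non-integral edges that either joins two distinct vertices of odd degree in the graph of
non-integral edges or is closed of even length. -/
def ModifyStep (G : SimpleGraph V) (x x' : Sym2 V → ℝ) : Prop :=
  ∃ (u v : V) (p : (nonIntegralGraph G x).Walk u v), p.IsTrail ∧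
    ((u ≠ v ∧ Odd ((nonIntegralGraph G x).neighborSet u).ncard ∧
        Odd ((nonIntegralGraph G x).neighborSet v).ncard) ∨
      (u = v ∧ Even p.length)) ∧
    x' = alternate x p.edges

open scoped Classical in
/-- The output of the mechanism: a vertex `i` on a non-integral odd cycle `C` (unique, as the
cycles in `𝒞` are disjoint) gets `(1 - 1/(l_C b_i)) b_i y_i`, any other vertex gets `b_i y_i`. -/
noncomputable def allocation {G : SimpleGraph V} (b : V → ℕ) (y : V → ℝ) (𝒞 : Set G.Subgraph)
    (i : V) : ℝ :=
  if h : ∃ C ∈ 𝒞, i ∈ C.verts then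
    (1 - 1 / ((cycleLength h.choose : ℝ) * b i)) * (b i * y i)
  else b i * y i

/-! ### The approximation factors -/

/-- The minimum length of the cycles in `𝒞` (`⊤` if `𝒞` is empty). -/
noncomputable def minLength {G : SimpleGraph V} (𝒞 : Set G.Subgraph) : ℕ∞ :=
  ⨅ C ∈ 𝒞, (cycleLength C : ℕ∞)

/-- The minimum capacity of a vertex on a cycle in `𝒞` (`⊤` if `𝒞` is empty). -/
noncomputable def minCapacityOn {G : SimpleGraph V} (b : V → ℕ) (𝒞 : Set G.Subgraph) : ℕ∞ :=
  ⨅ C ∈ 𝒞, ⨅ v ∈ C.verts, (b v : ℕ∞)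

/-- The minimum length of an odd cycle of `G` (`⊤` if `G` is bipartite). -/
noncomputable def minOddCycleLength (G : SimpleGraph V) : ℕ∞ :=
  minLength {C : G.Subgraph | IsOddCycle C}

/-- The minimum capacity of a vertex (`⊤` if there is no vertex). -/
noncomputable def minCapacity (b : V → ℕ) : ℕ∞ := ⨅ v, (b v : ℕ∞)

/-- The factor `1 - 1/(l β)`, with the convention `1/∞ = 0`. -/
noncomputable def factor (l β : ℕ∞) : ℝ := 1 - ((((l * β : ℕ∞) : ℝ≥0∞))⁻¹).toReal

/-! ### `γ` is a maximum -/

theorem le_of_isBMatching {H : SimpleGraph V} {b : V → ℕ} {z : Sym2 V → ℤ}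
    (hz : IsBMatching H b z) {e : Sym2 V} (he : e ∈ H.edgeSet) : z e ≤ ∑ v, (b v : ℤ) := by
  classical
  induction e with
  | _ u v =>
    have h1 : (z s(u, v) : ℝ) ≤ load H (fun e => (z e : ℝ)) u := by
      unfold load
      refine Finset.single_le_sum (f := fun e => (z e : ℝ)) (fun e' he' => ?_) ?_
      · simp only [Finset.mem_filter, SimpleGraph.mem_edgeFinset] at he'
        exact hz.2 e' he'.1
      · simpa using he
    have h2 : z s(u, v) ≤ (b u : ℤ) := by exact_mod_cast h1.trans (hz.1 u)
    exact h2.trans (Finset.single_le_sum (f := fun v => (b v : ℤ)) (fun _ _ => by positivity)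
      (Finset.mem_univ u))

theorem matchingWeights_finite (H : SimpleGraph V) (b : V → ℕ) (w : Sym2 V → ℝ) :
    (matchingWeights H b w).Finite := by
  classical
  refine (Set.finite_range (fun f : Sym2 V → Fin ((∑ v, b v) + 1) =>
    weight H w (fun e => ((f e : ℕ) : ℝ)))).subset ?_
  rintro r ⟨z, hz, rfl⟩
  refine ⟨fun e => Fin.ofNat _ (z e).toNat, ?_⟩
  refine Finset.sum_congr rfl fun e he => ?_
  have he' : e ∈ H.edgeSet := by simpa using he
  have h0 : 0 ≤ z e := by
    have h : (0 : ℝ) ≤ (z e : ℝ) := hz.2 e he'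
    exact_mod_cast h
  have h1 := le_of_isBMatching hz he'
  have h2 : (z e).toNat < (∑ v, b v) + 1 := by
    have : ((∑ v, b v : ℕ) : ℤ) = ∑ v, (b v : ℤ) := by push_cast; rfl
    omega
  have h3 : (((Fin.ofNat ((∑ v, b v) + 1) (z e).toNat : Fin _) : ℕ)) = (z e).toNat :=
    Nat.mod_eq_of_lt h2
  have h4 : (((z e).toNat : ℕ) : ℝ) = (z e : ℝ) := by
    have : (((z e).toNat : ℕ) : ℤ) = z e := Int.toNat_of_nonneg h0
    exact_mod_cast this
  simp only [h3, h4]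

theorem matchingWeights_nonempty (H : SimpleGraph V) (b : V → ℕ) (w : Sym2 V → ℝ) :
    (matchingWeights H b w).Nonempty :=
  ⟨_, fun _ => 0, ⟨by simp [load], by simp⟩, rfl⟩

/-- `γ(S)` is the largest weight of a `b`-matching in `G[S]`. -/
theorem gamma_isGreatest (G : SimpleGraph V) (b : V → ℕ) (w : Sym2 V → ℝ) (S : Set V) :
    IsGreatest (matchingWeights (inducedSubgraph G S) b w) (gamma G b w S) :=
  ⟨(matchingWeights_nonempty _ b w).csSup_mem (matchingWeights_finite _ b w),
    fun _ hr => le_csSup (matchingWeights_finite _ b w).bddAbove hr⟩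

end BMatchingGame

namespace BMatchingGame

variable {V : Type*} [Fintype V]

/-! ### Edge vectors and linear programming duality -/

/-! Two facts about linear programming carry the core inequalities. By weak duality on `G[S]`, every
coalition satisfies `γ(S) ≤ ∑_{i ∈ S} b_i y_i` (`gamma_le_sum`), and each vertex keeps at least the
stated fraction of `b_i y_i`; this gives the coalition bounds. By strong duality the optimum equals
`∑ b_i y_i`, so the grand coalition needs an integral `b`-matching that loses no more weight than
the mechanism withholds.

On a cycle `C` the mechanism withholds `y_i / l_C` from each vertex `i`, in total the average of `y`
over `C`. Start at a vertex `v` of `C` where `y` is smallest and alternate `-1/2, +1/2, …, -1/2`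
around the odd cycle: its edges become integral, only the load of `v` changes, and it falls by 1.
Complementary slackness gives `w_ij = y_i + y_j` on these edges, so the weight change telescopes to
`-y_v`, a loss of at most the average. Doing this for every cycle gives the matching
(`exists_bMatching_of_nonIntegralCycles`).

Strong duality (`exists_cover_le`) comes from a saddle point of the Lagrangian on large boxes.
Half-integrality (`exists_halfIntegral_max`) comes from an extreme optimal point, by counting
non-integral edges against tight vertices. For the modification (`exists_modification`), an
alternation along an admissible trail is feasible with either sign, hence preserves optimality, and
it lowers the number of non-integral edges; a graph without nonempty admissible trails is a disjoint
union of odd cycles and isolated vertices (`exists_trail_or_odd_cycles`). -/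

/-- The edge vector `y i + y j` induced by a vertex vector `y`. -/
def endSum (y : V → ℝ) : Sym2 V → ℝ :=
  Sym2.lift ⟨fun i j => y i + y j, fun _ _ => add_comm _ _⟩

omit [Fintype V] in
@[simp] theorem endSum_mk (y : V → ℝ) (i j : V) : endSum y s(i, j) = y i + y j := rfl

open scoped Classical in
theorem endSum_eq_sum {H : SimpleGraph V} (y : V → ℝ) {e : Sym2 V} (he : e ∈ H.edgeSet) :
    endSum y e = ∑ i, if i ∈ e then y i else 0 := by
  induction e with
  | _ u v =>
    have huv : u ≠ v := H.ne_of_adj he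
    rw [← Finset.sum_filter]
    have : (Finset.univ.filter fun i => i ∈ s(u, v)) = {u, v} := by ext; simp
    rw [this, Finset.sum_pair huv, endSum_mk]

open scoped Classical in
/-- Double counting: pairing with an induced edge vector is pairing with the loads. -/
theorem sum_endSum_mul (H : SimpleGraph V) (y : V → ℝ) (x : Sym2 V → ℝ) :
    ∑ e ∈ H.edgeFinset, endSum y e * x e = ∑ i, y i * load H x i := by
  have h1 : ∀ e ∈ H.edgeFinset, endSum y e * x e = ∑ i, if i ∈ e then y i * x e else 0 := by
    intro e he
    rw [endSum_eq_sum y (SimpleGraph.mem_edgeFinset.1 he), Finset.sum_mul]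
    exact Finset.sum_congr rfl fun i _ => by split_ifs <;> simp
  rw [Finset.sum_congr rfl h1, Finset.sum_comm]
  refine Finset.sum_congr rfl fun i _ => ?_
  rw [load, Finset.mul_sum, Finset.sum_filter]

theorem weight_endSum (H : SimpleGraph V) (y : V → ℝ) (x : Sym2 V → ℝ) :
    weight H (endSum y) x = ∑ i, y i * load H x i := sum_endSum_mul H y x

theorem weight_add (H : SimpleGraph V) (w x d : Sym2 V → ℝ) :
    weight H w (fun e => x e + d e) = weight H w x + weight H w d := by
  simp only [weight, mul_add, Finset.sum_add_distrib]

theorem load_add (H : SimpleGraph V) (x d : Sym2 V → ℝ) (v : V) :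
    load H (fun e => x e + d e) v = load H x v + load H d v := by
  simp only [load, Finset.sum_add_distrib]

theorem weight_mul (H : SimpleGraph V) (w d : Sym2 V → ℝ) (c : ℝ) :
    weight H w (fun e => c * d e) = c * weight H w d := by
  simp only [weight, Finset.mul_sum, mul_left_comm]

theorem load_mul (H : SimpleGraph V) (d : Sym2 V → ℝ) (c : ℝ) (v : V) :
    load H (fun e => c * d e) v = c * load H d v := by
  simp only [load, Finset.mul_sum]

open scoped Classical in
theorem load_nonneg {H : SimpleGraph V} {x : Sym2 V → ℝ} (hx : ∀ e ∈ H.edgeSet, 0 ≤ x e) (v : V) :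
    0 ≤ load H x v :=
  Finset.sum_nonneg fun e he => hx e (by simpa using (Finset.mem_filter.1 he).1)

open scoped Classical in
theorem le_load {H : SimpleGraph V} {x : Sym2 V → ℝ} (hx : ∀ e ∈ H.edgeSet, 0 ≤ x e) {v : V}
    {e : Sym2 V} (he : e ∈ H.edgeSet) (hv : v ∈ e) : x e ≤ load H x v := by
  unfold load
  refine Finset.single_le_sum (f := x) (fun e' he' => ?_) (by simp [he, hv])
  exact hx e' (by simpa using (Finset.mem_filter.1 he').1)

omit [Fintype V] in
theorem le_endSum {H : SimpleGraph V} {w : Sym2 V → ℝ} {y : V → ℝ} (hy : IsFractionalCover H w y)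
    {e : Sym2 V} (he : e ∈ H.edgeSet) : w e ≤ endSum y e := by
  induction e with
  | _ u v => exact hy.1 u v he

theorem weight_le_weight_endSum {H : SimpleGraph V} {w : Sym2 V → ℝ} {x : Sym2 V → ℝ} {y : V → ℝ}
    (hx : ∀ e ∈ H.edgeSet, 0 ≤ x e) (hy : IsFractionalCover H w y) :
    weight H w x ≤ weight H (endSum y) x :=
  Finset.sum_le_sum fun e he => by
    have he' : e ∈ H.edgeSet := by simpa using he
    exact mul_le_mul_of_nonneg_right (le_endSum hy he') (hx e he')

theorem weight_le_cover {H : SimpleGraph V} {b : V → ℕ} {w : Sym2 V → ℝ} {x : Sym2 V → ℝ}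
    {y : V → ℝ} (hx : IsFractionalBMatching H b x) (hy : IsFractionalCover H w y) :
    weight H w x ≤ ∑ i, (b i : ℝ) * y i := by
  refine (weight_le_weight_endSum hx.2 hy).trans ?_
  rw [weight_endSum]
  refine Finset.sum_le_sum fun i _ => ?_
  rw [mul_comm]
  exact mul_le_mul_of_nonneg_right (hx.1 i) (hy.2 i)

/-- Complementary slackness on the edges. -/
theorem eq_endSum_of_pos {H : SimpleGraph V} {b : V → ℕ} {w : Sym2 V → ℝ} {x : Sym2 V → ℝ}
    {y : V → ℝ} (hx : IsFractionalBMatching H b x) (hy : IsFractionalCover H w y)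
    (h : weight H w x = ∑ i, (b i : ℝ) * y i) {e : Sym2 V} (he : e ∈ H.edgeSet) (hpos : 0 < x e) :
    w e = endSum y e := by
  classical
  have h1 : weight H (endSum y) x ≤ ∑ i, (b i : ℝ) * y i := by
    rw [weight_endSum]
    refine Finset.sum_le_sum fun i _ => ?_
    rw [mul_comm]
    exact mul_le_mul_of_nonneg_right (hx.1 i) (hy.2 i)
  -- The value is squeezed between equal bounds, so the termwise inequalities `w e * x e ≤ endSum y
  -- e * x e` are all equalities.
  have h2 : weight H w x = weight H (endSum y) x :=
    le_antisymm (weight_le_weight_endSum hx.2 hy) (h ▸ h1)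
  have h3 := (Finset.sum_eq_sum_iff_of_le (s := H.edgeFinset) (f := fun e => w e * x e)
    (g := fun e => endSum y e * x e) (fun e he => by
      have he' : e ∈ H.edgeSet := by simpa using he
      exact mul_le_mul_of_nonneg_right (le_endSum hy he') (hx.2 e he'))).1
    (by unfold weight at h2; convert h2) e (by simpa using he)
  exact mul_right_cancel₀ hpos.ne' h3

/-! ### Alternating vectors along trails -/

open scoped Classical in
/-- The vector with the values `s, -s, s, …` along the edges of a list without repetition. -/
noncomputable def altVec (s : ℝ) : List (Sym2 V) → Sym2 V → ℝ
  | [], _ => 0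
  | a :: T, e => if e = a then s else altVec (-s) T e

omit [Fintype V] in
theorem altVec_of_notMem (s : ℝ) {T : List (Sym2 V)} {e : Sym2 V} (he : e ∉ T) :
    altVec s T e = 0 := by
  induction T generalizing s with
  | nil => rfl
  | cons a T ih =>
    rw [List.mem_cons, not_or] at he
    simp [altVec, he.1, ih _ he.2]

omit [Fintype V] in
theorem altVec_of_mem (s : ℝ) {T : List (Sym2 V)} {e : Sym2 V} (he : e ∈ T) :
    altVec s T e = s ∨ altVec s T e = -s := by
  induction T generalizing s with
  | nil => simp at he
  | cons a T ih =>
    by_cases h : e = a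
    · simp [altVec, h]
    · have := ih (-s) ((List.mem_cons.1 he).resolve_left h)
      simp only [altVec, h, if_false]
      rw [neg_neg] at this
      exact this.symm

omit [Fintype V] in
theorem altVec_neg (s : ℝ) (T : List (Sym2 V)) (e : Sym2 V) :
    altVec (-s) T e = (-1) * altVec s T e := by
  induction T generalizing s with
  | nil => simp [altVec]
  | cons a T ih =>
    by_cases h : e = a
    · simp [altVec, h]
    · simp [altVec, h, ih]

-- The recursive form suits induction along a trail; this links it to the index parity used in
-- `alternate`.
open scoped Classical in
omit [Fintype V] in
theorem altVec_eq_ite (s : ℝ) (T : List (Sym2 V)) (e : Sym2 V) :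
    altVec s T e = if e ∈ T then (if Even (T.idxOf e) then s else -s) else 0 := by
  induction T generalizing s with
  | nil => simp [altVec]
  | cons a T ih =>
    by_cases h : e = a
    · simp [altVec, h]
    · have h' : a ≠ e := fun h' => h h'.symm
      simp only [altVec, h, if_false, ih, List.mem_cons, false_or, List.idxOf_cons_ne _ h',
        Nat.succ_eq_add_one, Nat.even_add_one, neg_neg]
      split_ifs <;> rfl

omit [Fintype V] in
theorem alternate_eq_add (x : Sym2 V → ℝ) (T : List (Sym2 V)) :
    alternate x T = fun e => x e + altVec (-(1 / 2)) T e := by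
  classical
  funext e
  rw [alternate, altVec_eq_ite]
  split_ifs <;> ring

open scoped Classical in
/-- Pairing an alternating vector along a trail with an induced edge vector telescopes. -/
theorem weight_endSum_altVec {H K : SimpleGraph V} (hK : K ≤ H) (y : V → ℝ) (s : ℝ) {u v : V}
    (p : K.Walk u v) (hp : p.IsTrail) :
    weight H (endSum y) (altVec s p.edges) = s * (y u - (-1) ^ p.length * y v) := by
  induction p generalizing s with
  | nil => simp [weight, altVec]
  | @cons u t v h p ih =>
    rw [SimpleGraph.Walk.isTrail_cons] at hp
    have he : s(u, t) ∈ H.edgeFinset := by simpa using hK h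
    have h1 : ∀ e, endSum y e * altVec s (SimpleGraph.Walk.cons h p).edges e =
        (if e = s(u, t) then (y u + y t) * s else 0) + endSum y e * altVec (-s) p.edges e := by
      intro e
      by_cases hh : e = s(u, t)
      · subst hh
        simp [altVec, altVec_of_notMem _ hp.2]
      · simp [altVec, hh]
    have h2 := ih (-s) hp.1
    rw [weight] at h2 ⊢
    rw [Finset.sum_congr rfl fun e _ => h1 e, Finset.sum_add_distrib, h2, Finset.sum_ite_eq',
      if_pos he, SimpleGraph.Walk.length_cons, pow_succ]
    ring

-- `weight_endSum_altVec` tested on the indicator of `i`. Only the ends feel the alternation: a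
-- closed even trail changes no load, a closed odd one changes its base vertex by `2 * s`.
open scoped Classical in
theorem load_altVec {H K : SimpleGraph V} (hK : K ≤ H) (s : ℝ) {u v : V}
    (p : K.Walk u v) (hp : p.IsTrail) (i : V) :
    load H (altVec s p.edges) i =
      s * ((if u = i then 1 else 0) - (-1) ^ p.length * (if v = i then 1 else 0)) := by
  have h := weight_endSum_altVec hK (fun j => if j = i then 1 else 0) s p hp
  rw [weight_endSum] at h
  simpa using h

/-! ### Strong duality -/

/-- Scaling down an overloaded nonnegative vector loses at most `M` times the total overload. -/
theorem exists_bMatching_of_overload {H : SimpleGraph V} {b : V → ℕ} {w : Sym2 V → ℝ} {M : ℝ}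
    (hM : ∀ e, |w e| ≤ M) {x : Sym2 V → ℝ} (hx : ∀ e, 0 ≤ x e) :
    ∃ x', IsFractionalBMatching H b x' ∧
      weight H w x - M * ∑ i, max 0 (load H x i - b i) ≤ weight H w x' := by
  classical
  set θ : V → ℝ := fun i => if (b i : ℝ) < load H x i then b i / load H x i else 1 with hθ
  have hl : ∀ i, 0 ≤ load H x i := fun i => load_nonneg (fun e _ => hx e) i
  have h0 : ∀ i, 0 ≤ θ i := fun i => by
    simp only [hθ]; split_ifs
    · exact div_nonneg (Nat.cast_nonneg _) (hl i)
    · exact zero_le_one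
  have h1 : ∀ i, θ i ≤ 1 := fun i => by
    simp only [hθ]; split_ifs with h
    · exact div_le_one_of_le₀ h.le (hl i)
    · exact le_rfl
  have h2 : ∀ i, θ i * load H x i ≤ b i := fun i => by
    simp only [hθ]; split_ifs with h
    · rw [div_mul_cancel₀ _ ((Nat.cast_nonneg _).trans_lt h).ne']
    · simpa using h
  have h3 : ∀ i, (1 - θ i) * load H x i = max 0 (load H x i - b i) := fun i => by
    simp only [hθ]; split_ifs with h
    · rw [sub_mul, div_mul_cancel₀ _ ((Nat.cast_nonneg _).trans_lt h).ne', one_mul,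
        max_eq_right (by linarith)]
    · rw [max_eq_left (by linarith)]; simp
  -- Each edge is scaled by the factors of both ends. Since `1 - θ i * θ j ≤ (1 - θ i) + (1 - θ j)`
  -- and `(1 - θ i) * load` is the overload at `i`, the lost weight is controlled by double
  -- counting.
  set π : Sym2 V → ℝ := Sym2.lift ⟨fun i j => θ i * θ j, fun _ _ => mul_comm _ _⟩ with hπ
  have hπ0 : ∀ e, 0 ≤ π e := fun e => by
    induction e with | _ i j => exact mul_nonneg (h0 i) (h0 j)
  have hπle : ∀ e, ∀ i ∈ e, π e ≤ θ i := fun e => by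
    induction e with
    | _ i j =>
      intro k hk
      have h : π s(i, j) = θ i * θ j := rfl
      rw [h]
      rcases Sym2.mem_iff.1 hk with rfl | rfl
      · exact mul_le_of_le_one_right (h0 _) (h1 _)
      · exact mul_le_of_le_one_left (h0 _) (h1 _)
  have hπ1 : ∀ e, π e ≤ 1 := fun e => by
    induction e with | _ i j => exact (hπle _ i (by simp)).trans (h1 i)
  have hπs : ∀ e, 1 - π e ≤ endSum (fun i => 1 - θ i) e := fun e => by
    induction e with
    | _ i j =>
      have h : π s(i, j) = θ i * θ j := rfl
      rw [h, endSum_mk]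
      nlinarith [mul_nonneg (sub_nonneg.2 (h1 i)) (sub_nonneg.2 (h1 j))]
  refine ⟨fun e => π e * x e, ⟨fun i => ?_, fun e _ => mul_nonneg (hπ0 e) (hx e)⟩, ?_⟩
  · refine le_trans ?_ (h2 i)
    rw [load, load, Finset.mul_sum]
    exact Finset.sum_le_sum fun e he =>
      mul_le_mul_of_nonneg_right (hπle e i (Finset.mem_filter.1 he).2) (hx e)
  · have h4 : M * ∑ i, max 0 (load H x i - b i) = ∑ e ∈ H.edgeFinset,
        M * (endSum (fun i => 1 - θ i) e * x e) := by
      rw [← Finset.mul_sum, sum_endSum_mul]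
      simp only [h3]
    rw [h4, weight, weight, ← Finset.sum_sub_distrib]
    refine Finset.sum_le_sum fun e _ => ?_
    have h5 : w e * (1 - π e) ≤ M * endSum (fun i => 1 - θ i) e :=
      mul_le_mul ((le_abs_self _).trans (hM e)) (hπs e) (sub_nonneg.2 (hπ1 e))
        ((abs_nonneg _).trans (hM e))
    nlinarith [mul_le_mul_of_nonneg_right h5 (hx e)]

/-- Raising a nonnegative vector to a cover costs at most `K` times the total violation. -/
theorem exists_cover_of_violation {H : SimpleGraph V} {b : V → ℕ} {w : Sym2 V → ℝ} {K : ℝ}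
    (hK : ∀ e, endSum (fun i => (b i : ℝ)) e ≤ K) {y : V → ℝ} (hy : ∀ i, 0 ≤ y i) :
    ∃ y', IsFractionalCover H w y' ∧ ∑ i, (b i : ℝ) * y' i ≤
      ∑ i, (b i : ℝ) * y i + weight H (fun e => max 0 (w e - endSum y e)) fun _ => K := by
  set exc : Sym2 V → ℝ := fun e => max 0 (w e - endSum y e) with hexc
  have h0 : ∀ e ∈ H.edgeSet, 0 ≤ exc e := fun e _ => le_max_left _ _
  -- Every vertex absorbs the violations of all its edges; one end alone would already repair an
  -- edge.
  refine ⟨fun i => y i + load H exc i, ⟨fun i j hij => ?_, fun i =>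
    add_nonneg (hy i) (load_nonneg h0 i)⟩, ?_⟩
  · have h1 : exc s(i, j) ≤ load H exc i := le_load h0 hij (by simp)
    have h2 : 0 ≤ load H exc j := load_nonneg h0 j
    have h3 : w s(i, j) - (y i + y j) ≤ exc s(i, j) := le_max_right _ _
    linarith
  · simp only [mul_add, Finset.sum_add_distrib]
    gcongr
    rw [← weight_endSum, weight, weight]
    refine Finset.sum_le_sum fun e _ => ?_
    rw [mul_comm]
    exact mul_le_mul_of_nonneg_left (hK e) (le_max_left _ _)

open scoped Classical in
/-- Strong duality: any upper bound for the weights of the fractional `b`-matchings bounds the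
value of some cover. -/
theorem exists_cover_le {H : SimpleGraph V} {b : V → ℕ} {w : Sym2 V → ℝ} {r : ℝ}
    (hr : ∀ x, IsFractionalBMatching H b x → weight H w x ≤ r) :
    ∃ y, IsFractionalCover H w y ∧ ∑ i, (b i : ℝ) * y i ≤ r := by
  -- `M` and `K` are exact penalties: they bound the edge weights and the sums `b i + b j`, as the
  -- two repair lemmas require. They also bound the boxes, making them compact.
  set M : ℝ := ∑ e, |w e| with hM
  set K : ℝ := 2 * ∑ i, (b i : ℝ) with hK
  have hM0 : 0 ≤ M := Finset.sum_nonneg fun _ _ => abs_nonneg _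
  have hK0 : 0 ≤ K := by positivity
  have hMw : ∀ e, |w e| ≤ M := fun e =>
    Finset.single_le_sum (f := fun e => |w e|) (fun _ _ => abs_nonneg _) (Finset.mem_univ e)
  have hKb : ∀ e, endSum (fun i => (b i : ℝ)) e ≤ K := fun e => by
    induction e with
    | _ i j =>
      have h : ∀ k, (b k : ℝ) ≤ ∑ i, (b i : ℝ) := fun k =>
        Finset.single_le_sum (f := fun i => (b i : ℝ)) (fun _ _ => Nat.cast_nonneg _)
          (Finset.mem_univ k)
      rw [endSum_mk, hK]; linarith [h i, h j]
  set X : Set (V → ℝ) := Set.Icc 0 (fun _ => M) with hX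
  set Y : Set (Sym2 V → ℝ) := Set.Icc 0 (fun _ => K) with hY
  set f : (V → ℝ) → (Sym2 V → ℝ) → ℝ := fun y x => weight H w x + ∑ i, y i * (b i - load H x i)
    with hf
  have hf1 : ∀ x, Continuous fun y => f y x := fun x => by simp only [hf]; fun_prop
  have hf2 : ∀ y, Continuous fun x => f y x := fun y => by
    simp only [hf, weight, load]; fun_prop
  have hc1 : ∀ x, ∀ y y' : V → ℝ, ∀ s t : ℝ, s + t = 1 →
      f (s • y + t • y') x = s * f y x + t * f y' x := fun x y y' s t hst => by
    have : t = 1 - s := by linarith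
    subst this
    simp only [hf, Pi.add_apply, Pi.smul_apply, smul_eq_mul, add_mul, Finset.sum_add_distrib,
      mul_assoc, ← Finset.mul_sum]
    ring
  have hc2 : ∀ y, ∀ x x' : Sym2 V → ℝ, ∀ s t : ℝ, s + t = 1 →
      f y (s • x + t • x') = s * f y x + t * f y x' := fun y x x' s t hst => by
    have h1 : weight H w (s • x + t • x') = s * weight H w x + t * weight H w x' := by
      rw [← weight_mul, ← weight_mul, ← weight_add]; rfl
    have h2 : ∀ i, load H (s • x + t • x') i = s * load H x i + t * load H x' i := fun i => by
      rw [← load_mul, ← load_mul, ← load_add]; rfl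
    have h3 : ∑ i, y i * (b i - load H (s • x + t • x') i) =
        s * ∑ i, y i * (b i - load H x i) + t * ∑ i, y i * (b i - load H x' i) := by
      rw [Finset.mul_sum, Finset.mul_sum, ← Finset.sum_add_distrib]
      refine Finset.sum_congr rfl fun i _ => ?_
      have : t = 1 - s := by linarith
      rw [h2, this]; ring
    simp only [hf]
    rw [h1, h3]; ring
  obtain ⟨y, hyX, x, hxY, hs⟩ := Sion.exists_isSaddlePointOn' (X := X) (Y := Y) (f := f)
    (ne_X := ⟨0, le_rfl, fun _ => hM0⟩) (cX := convex_Icc _ _) (kX := isCompact_Icc)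
    (hfy := fun x _ => (hf1 x).continuousOn.lowerSemicontinuousOn)
    (hfy' := fun x _ => ConvexOn.quasiconvexOn (f := fun y => f y x)
      ⟨convex_Icc _ _, fun y _ y' _ s t _ _ hst => (hc1 x y y' s t hst).le⟩)
    (cY := convex_Icc _ _)
    (hfx := fun y _ => (hf2 y).continuousOn.upperSemicontinuousOn)
    (hfx' := fun y _ => ConcaveOn.quasiconcaveOn (f := fun x => f y x)
      ⟨convex_Icc _ _, fun x _ x' _ s t _ _ hst => (hc2 y x x' s t hst).ge⟩)
    (ne_Y := ⟨0, le_rfl, fun _ => hK0⟩) (kY := isCompact_Icc)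
  obtain ⟨y', hy', hyle⟩ := exists_cover_of_violation (H := H) (w := w) hKb hyX.1
  obtain ⟨x', hx', hxle⟩ := exists_bMatching_of_overload (H := H) (b := b) hMw hxY.1
  refine ⟨y', hy', ?_⟩
  -- The saddle inequality is tested on the best responses: price `M` at overloaded vertices, value
  -- `K` on violated edges. Both sides become penalised objectives, which the repairs turn into the
  -- values of `y'` and `x'`.
  have key := hs (fun i => if (b i : ℝ) < load H x i then M else 0)
    ⟨fun i => by dsimp; split_ifs <;> simp [hM0], fun i => by dsimp; split_ifs <;> simp [hM0]⟩
    (fun e => if 0 < w e - endSum y e then K else 0)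
    ⟨fun i => by dsimp; split_ifs <;> simp [hK0], fun i => by dsimp; split_ifs <;> simp [hK0]⟩
  have h1 : f y (fun e => if 0 < w e - endSum y e then K else 0) =
      ∑ i, (b i : ℝ) * y i + weight H (fun e => max 0 (w e - endSum y e)) fun _ => K := by
    simp only [hf, mul_sub, Finset.sum_sub_distrib]
    rw [← weight_endSum, add_comm, sub_add_eq_add_sub, add_sub_assoc]
    congr 1
    · exact Finset.sum_congr rfl fun _ _ => mul_comm _ _
    · rw [weight, weight, weight, ← Finset.sum_sub_distrib]
      refine Finset.sum_congr rfl fun e _ => ?_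
      split_ifs with h
      · rw [max_eq_right h.le]; ring
      · rw [max_eq_left (not_lt.1 h)]; ring
  have h2 : f (fun i => if (b i : ℝ) < load H x i then M else 0) x =
      weight H w x - M * ∑ i, max 0 (load H x i - b i) := by
    simp only [hf]
    rw [sub_eq_add_neg, Finset.mul_sum, ← Finset.sum_neg_distrib]
    congr 1
    refine Finset.sum_congr rfl fun i _ => ?_
    split_ifs with h
    · rw [max_eq_right (by linarith)]; ring
    · rw [max_eq_left (by linarith)]; ring
  rw [h1, h2] at key
  linarith [hr x' hx']

/-! ### Half-integral optima -/

/-- The polytope of the fractional `b`-matchings that vanish outside the edge set. -/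
def bMatchingPolytope (H : SimpleGraph V) (b : V → ℕ) : Set (Sym2 V → ℝ) :=
  {x | IsFractionalBMatching H b x ∧ ∀ e ∉ H.edgeSet, x e = 0}

open scoped Classical in
theorem continuous_load (H : SimpleGraph V) (v : V) : Continuous fun x => load H x v := by
  unfold load; fun_prop

open scoped Classical in
theorem continuous_weight (H : SimpleGraph V) (w : Sym2 V → ℝ) : Continuous (weight H w) := by
  unfold weight; fun_prop

theorem isCompact_bMatchingPolytope (H : SimpleGraph V) (b : V → ℕ) :
    IsCompact (bMatchingPolytope H b) := by
  have hsub : bMatchingPolytope H b ⊆ Set.Icc 0 (fun _ => ∑ v, (b v : ℝ)) := by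
    rintro x ⟨hx, hx0⟩
    have h : ∀ e, 0 ≤ x e ∧ x e ≤ ∑ v, (b v : ℝ) := fun e => by
      by_cases he : e ∈ H.edgeSet
      · refine ⟨hx.2 e he, ?_⟩
        induction e with
        | _ u v =>
          refine ((le_load hx.2 he (Sym2.mem_mk_left u v)).trans (hx.1 u)).trans ?_
          exact Finset.single_le_sum (f := fun i => (b i : ℝ)) (fun _ _ => Nat.cast_nonneg _)
            (Finset.mem_univ u)
      · rw [hx0 e he]
        exact ⟨le_rfl, Finset.sum_nonneg fun _ _ => Nat.cast_nonneg _⟩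
    exact ⟨fun e => (h e).1, fun e => (h e).2⟩
  refine isCompact_Icc.of_isClosed_subset ?_ hsub
  have : bMatchingPolytope H b = ((⋂ v, {x | load H x v ≤ b v}) ∩
      ⋂ e ∈ H.edgeSet, {x | 0 ≤ x e}) ∩ ⋂ e ∈ H.edgeSetᶜ, {x | x e = 0} := by
    ext x; simp [bMatchingPolytope, IsFractionalBMatching]
  rw [this]
  refine ((isClosed_iInter fun v => isClosed_le (continuous_load H v) continuous_const).inter
    (isClosed_biInter fun e _ => isClosed_le continuous_const (continuous_apply e))).inter
    (isClosed_biInter fun e _ => isClosed_eq (continuous_apply e) continuous_const)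

-- Values off the edge set are unconstrained, so they are set to zero to make the feasible region
-- compact.
open scoped Classical in
theorem exists_mem_polytope (H : SimpleGraph V) {b : V → ℕ} (w : Sym2 V → ℝ) {x : Sym2 V → ℝ}
    (hx : IsFractionalBMatching H b x) :
    ∃ x' ∈ bMatchingPolytope H b, weight H w x' = weight H w x := by
  refine ⟨fun e => if e ∈ H.edgeSet then x e else 0, ⟨⟨fun v => ?_, fun e he => ?_⟩,
    fun e he => by simp [he]⟩, ?_⟩
  · refine le_trans (le_of_eq ?_) (hx.1 v)
    exact Finset.sum_congr rfl fun e he => if_pos (by simpa using (Finset.mem_filter.1 he).1)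
  · simpa [he] using hx.2 e he
  · refine Finset.sum_congr rfl fun e he => ?_
    have he' : e ∈ H.edgeSet := by simpa using he
    simp only [he', if_true]

/-- The polytope has an optimal point that is not the midpoint of two other feasible points. -/
theorem exists_extreme_optimum (H : SimpleGraph V) (b : V → ℕ) (w : Sym2 V → ℝ) :
    ∃ x ∈ bMatchingPolytope H b, IsMaxFractionalBMatching H b w x ∧
      ∀ d : Sym2 V → ℝ, (fun e => x e + d e) ∈ bMatchingPolytope H b →
        (fun e => x e + -1 * d e) ∈ bMatchingPolytope H b → d = 0 := by
  have hc := isCompact_bMatchingPolytope H b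
  have hne : (bMatchingPolytope H b).Nonempty :=
    ⟨fun _ => 0, ⟨⟨fun v => by simp [load], by simp⟩, by simp⟩⟩
  obtain ⟨x₀, hx₀, hmax⟩ := hc.exists_isMaxOn hne (continuous_weight H w).continuousOn
  obtain ⟨x, hx⟩ := (hc.inter_right (isClosed_le (continuous_const (y := weight H w x₀))
    (continuous_weight H w))).extremePoints_nonempty ⟨x₀, hx₀, le_refl (weight H w x₀)⟩
  have hopt : ∀ x' ∈ bMatchingPolytope H b, weight H w x' ≤ weight H w x := fun x' hx' =>
    (hmax hx').trans hx.1.2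
  refine ⟨x, hx.1.1, ⟨hx.1.1.1, fun x' hx' => ?_⟩, fun d h1 h2 => ?_⟩
  · obtain ⟨x'', h, h'⟩ := exists_mem_polytope H w hx'
    exact h' ▸ hopt x'' h
  · have e1 := hopt _ h1
    have e2 := hopt _ h2
    rw [weight_add] at e1 e2
    rw [weight_mul] at e2
    -- Hence both `x + d` and `x - d` lie on the optimal face, of which `x` is an extreme point.
    have e3 : weight H w d = 0 := by linarith
    have hx2 : weight H w x₀ ≤ weight H w x := hx.1.2
    have h3 := (mem_extremePoints.1 hx).2 _ ⟨h1, by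
      rw [Set.mem_ofPred_eq, weight_add, e3]; simpa using hx2⟩ _ ⟨h2, by
      rw [Set.mem_ofPred_eq, weight_add, weight_mul, e3]; simpa using hx2⟩
      ⟨1 / 2, 1 / 2, by norm_num, by norm_num, by norm_num, by
        funext e; simp only [Pi.add_apply, Pi.smul_apply, smul_eq_mul]; ring⟩
    funext e
    have := congrFun h3.1 e
    simpa using this

/-- A point of the polytope can be moved slightly in both directions `± d`, if `d` is supported on
positive edges and does not change tight loads. -/
theorem exists_pos_perturbation {H : SimpleGraph V} {b : V → ℕ} {x d : Sym2 V → ℝ}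
    (hx : x ∈ bMatchingPolytope H b) (h1 : ∀ e, x e = 0 → d e = 0)
    (h2 : ∀ v, load H x v = b v → load H d v = 0) :
    ∃ t : ℝ, 0 < t ∧ (fun e => x e + t * d e) ∈ bMatchingPolytope H b ∧
      (fun e => x e + -1 * (t * d e)) ∈ bMatchingPolytope H b := by
  have key : ∀ᶠ t : ℝ in nhds 0, (fun e => x e + t * d e) ∈ bMatchingPolytope H b := by
    have k1 : ∀ e, ∀ᶠ t : ℝ in nhds 0, e ∈ H.edgeSet → 0 ≤ x e + t * d e := fun e => by
      by_cases he : e ∈ H.edgeSet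
      · by_cases h : x e = 0
        · simp [h, h1 e h]
        · have hpos : 0 < x e := (hx.1.2 e he).lt_of_ne' h
          have hcont : Continuous fun t : ℝ => x e + t * d e := by fun_prop
          filter_upwards [hcont.continuousAt.eventually_mem
            (Ioi_mem_nhds (show (0 : ℝ) < x e + 0 * d e by simpa using hpos))] with t ht _
          exact le_of_lt ht
      · simp [he]
    have k2 : ∀ v, ∀ᶠ t : ℝ in nhds 0, load H x v + t * load H d v ≤ b v := fun v => by
      rcases (hx.1.1 v).eq_or_lt with h | h
      · simp [h, h2 v h]
      · have hcont : Continuous fun t : ℝ => load H x v + t * load H d v := by fun_prop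
        filter_upwards [hcont.continuousAt.eventually_mem
          (Iio_mem_nhds (show load H x v + 0 * load H d v < b v by simpa using h))] with t ht
        exact le_of_lt ht
    filter_upwards [Filter.eventually_all.2 k1, Filter.eventually_all.2 k2] with t t1 t2
    refine ⟨⟨fun v => ?_, fun e he => t1 e he⟩, fun e he => ?_⟩
    · rw [load_add, load_mul]; exact t2 v
    · simp [hx.2 e he, h1 e (hx.2 e he)]
  have key' : ∀ᶠ t : ℝ in nhds 0, (fun e => x e + -t * d e) ∈ bMatchingPolytope H b := by
    have := (continuous_neg (G := ℝ)).tendsto 0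
    rw [neg_zero] at this
    exact this.eventually key
  obtain ⟨t, ⟨ht1, ht2⟩, ht⟩ := (((key.and key').filter_mono nhdsWithin_le_nhds).and
    (self_mem_nhdsWithin : Set.Ioi (0 : ℝ) ∈ nhdsWithin 0 (Set.Ioi 0))).exists
  exact ⟨t, ht, ht1, by simpa only [neg_mul, one_mul] using ht2⟩

/-! ### Fractional parts and the graph of non-integral edges -/

theorem isInteger_iff_fract {r : ℝ} : IsInteger r ↔ Int.fract r = 0 := by
  rw [Int.fract_eq_zero_iff]
  exact ⟨fun ⟨n, h⟩ => ⟨n, h.symm⟩, fun ⟨n, h⟩ => ⟨n, h.symm⟩⟩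

open scoped Classical in
/-- The non-integral edges of an edge vector. -/
noncomputable def fracEdges (H : SimpleGraph V) (x : Sym2 V → ℝ) : Finset (Sym2 V) :=
  H.edgeFinset.filter fun e => ¬ IsInteger (x e)

open scoped Classical in
/-- The number of non-integral edges at a vertex. -/
noncomputable def fracDegree (H : SimpleGraph V) (x : Sym2 V → ℝ) (v : V) : ℕ :=
  ((fracEdges H x).filter fun e => v ∈ e).card

theorem mem_fracEdges {H : SimpleGraph V} {x : Sym2 V → ℝ} {e : Sym2 V} :
    e ∈ fracEdges H x ↔ e ∈ H.edgeSet ∧ ¬ IsInteger (x e) := by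
  simp [fracEdges]

open scoped Classical in
theorem load_eq_sum_fracEdges {H : SimpleGraph V} {x d : Sym2 V → ℝ}
    (hd : ∀ e, IsInteger (x e) → d e = 0) (v : V) :
    load H d v = ∑ e ∈ (fracEdges H x).filter fun e => v ∈ e, d e := by
  refine (Finset.sum_subset (fun e he => ?_) fun e he he' => ?_).symm
  · simp only [Finset.mem_filter, mem_fracEdges, SimpleGraph.mem_edgeFinset] at he ⊢
    exact ⟨he.1.1, he.2⟩
  · simp only [Finset.mem_filter, mem_fracEdges, SimpleGraph.mem_edgeFinset, not_and] at he he'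
    by_contra h
    exact he' ⟨he.1, fun hi => h (hd e hi)⟩ he.2

theorem load_fract_of_isInteger {H : SimpleGraph V} {x : Sym2 V → ℝ} {v : V}
    (hv : IsInteger (load H x v)) : IsInteger (load H (fun e => Int.fract (x e)) v) := by
  classical
  obtain ⟨n, hn⟩ := hv
  refine ⟨n - ∑ e ∈ H.edgeFinset with v ∈ e, ⌊x e⌋, ?_⟩
  rw [load] at hn ⊢
  push_cast
  rw [← hn, ← Finset.sum_sub_distrib]
  rfl

/-- At a vertex of integral load with `k > 0` non-integral edges, the fractional parts sum to an
integer strictly between `0` and `k`. -/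
theorem load_fract_bounds {H : SimpleGraph V} {x : Sym2 V → ℝ} {v : V}
    (hv : IsInteger (load H x v)) (hpos : 0 < fracDegree H x v) :
    ∃ n : ℤ, load H (fun e => Int.fract (x e)) v = n ∧ 0 < n ∧ n < fracDegree H x v := by
  classical
  obtain ⟨n, hn⟩ := load_fract_of_isInteger hv
  have h := load_eq_sum_fracEdges (H := H) (x := x) (d := fun e => Int.fract (x e))
    (fun e he => isInteger_iff_fract.1 he) v
  have hne : ((fracEdges H x).filter fun e => v ∈ e).Nonempty := Finset.card_pos.1 hpos
  refine ⟨n, hn, ?_, ?_⟩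
  · have : (0 : ℝ) < n := by
      rw [← hn, h]
      refine Finset.sum_pos (fun e he => ?_) hne
      exact (Int.fract_nonneg _).lt_of_ne'
        (mt isInteger_iff_fract.2 (mem_fracEdges.1 (Finset.mem_filter.1 he).1).2)
    exact_mod_cast this
  · have : (n : ℝ) < fracDegree H x v := by
      rw [← hn, h, fracDegree, Finset.cast_card]
      exact Finset.sum_lt_sum_of_nonempty hne fun e _ => Int.fract_lt_one _
    exact_mod_cast this

theorem sum_fracDegree (H : SimpleGraph V) (x : Sym2 V → ℝ) :
    ∑ v, fracDegree H x v = 2 * (fracEdges H x).card := by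
  classical
  have h := Finset.sum_card_bipartiteAbove_eq_sum_card_bipartiteBelow
    (s := (Finset.univ : Finset V)) (t := fracEdges H x) (r := fun v e => v ∈ e)
  have h2 : ∀ e ∈ fracEdges H x,
      (Finset.bipartiteBelow (fun v e => v ∈ e) (Finset.univ : Finset V) e).card = 2 := by
    intro e he
    have he' := (mem_fracEdges.1 he).1
    clear he
    induction e with
    | _ i j =>
      have : Finset.bipartiteBelow (fun v e => v ∈ e) (Finset.univ : Finset V) s(i, j) = {i, j} := by
        ext; simp [Finset.bipartiteBelow]
      rw [this, Finset.card_pair (H.ne_of_adj he')]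
  rw [Finset.sum_congr rfl h2, Finset.sum_const, smul_eq_mul, mul_comm] at h
  rw [← h]
  refine Finset.sum_congr rfl fun v _ => ?_
  unfold fracDegree Finset.bipartiteAbove
  congr

open scoped Classical in
/-- More edges than vertices: some nonzero vector on the edges has zero sum at all vertices. -/
theorem exists_ne_zero_of_card_lt (B : Finset (Sym2 V)) (T : Finset V) (h : T.card < B.card) :
    ∃ d : Sym2 V → ℝ, d ≠ 0 ∧ (∀ e ∉ B, d e = 0) ∧ ∀ v ∈ T, ∑ e ∈ B with v ∈ e, d e = 0 := by
  let A : Matrix T B ℝ := Matrix.of fun v e => if (v : V) ∈ (e : Sym2 V) then 1 else 0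
  have hker : LinearMap.ker A.mulVecLin ≠ ⊥ :=
    LinearMap.ker_ne_bot_of_finrank_lt (by simpa using h)
  obtain ⟨g, hg, hg0⟩ := Submodule.exists_mem_ne_zero_of_ne_bot hker
  refine ⟨fun e => if h : e ∈ B then g ⟨e, h⟩ else 0, fun h0 => hg0 ?_, fun e he => by simp [he],
    fun v hv => ?_⟩
  · funext e
    have := congrFun h0 e.1
    simpa using this
  · have h1 := congrFun (LinearMap.mem_ker.1 hg) ⟨v, hv⟩
    simp only [Matrix.mulVecLin_apply, Matrix.mulVec, dotProduct, A, Matrix.of_apply, ite_mul,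
      one_mul, zero_mul, Pi.zero_apply] at h1
    rw [Finset.sum_filter, ← Finset.sum_coe_sort]
    simpa using h1

/-- A half-integral maximum fractional `b`-matching exists. -/
theorem exists_halfIntegral_max (H : SimpleGraph V) (b : V → ℕ) (w : Sym2 V → ℝ) :
    ∃ x, IsMaxFractionalBMatching H b w x ∧ IsHalfIntegral H x := by
  classical
  obtain ⟨x, hxP, hx, hext⟩ := exists_extreme_optimum H b w
  refine ⟨x, hx, ?_⟩
  -- Extremality in usable form: no nonzero direction lives on the non-integral edges and keeps all
  -- tight loads.
  have hd : ∀ d : Sym2 V → ℝ, (∀ e ∉ fracEdges H x, d e = 0) →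
      (∀ v, load H x v = b v → load H d v = 0) → d = 0 := by
    intro d h1 h2
    obtain ⟨t, ht, ht1, ht2⟩ := exists_pos_perturbation hxP (d := d)
      (fun e he => h1 e fun h => (mem_fracEdges.1 h).2 ⟨0, by simpa using he⟩) h2
    have h3 := hext (fun e => t * d e) ht1 ht2
    funext e
    simpa [ht.ne'] using congrFun h3 e
  have hint : ∀ v, load H x v = b v → IsInteger (load H x v) := fun v hv => ⟨b v, by simp [hv]⟩
  have hsupp : ∀ {d : Sym2 V → ℝ}, (∀ e ∉ fracEdges H x, d e = 0) →
      ∀ e, IsInteger (x e) → d e = 0 := fun h e he => h e fun h' => (mem_fracEdges.1 h').2 he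
  set T : Finset V := Finset.univ.filter fun v => load H x v = b v ∧ 0 < fracDegree H x v with hT
  -- Otherwise the vertex-edge incidence matrix has a nonzero kernel vector, contradicting `hd`.
  have hcard : (fracEdges H x).card ≤ T.card := by
    by_contra! hlt
    obtain ⟨d, hd0, hd1, hd2⟩ := exists_ne_zero_of_card_lt _ _ hlt
    refine hd0 (hd d hd1 fun v hv => ?_)
    rw [load_eq_sum_fracEdges (hsupp hd1)]
    by_cases hdeg : 0 < fracDegree H x v
    · convert hd2 v (by simp [hT, hv, hdeg])
    · rw [fracDegree, Finset.card_pos, Finset.not_nonempty_iff_eq_empty] at hdeg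
      rw [hdeg, Finset.sum_empty]
  have hdeg2 : ∀ v ∈ T, 2 ≤ fracDegree H x v := fun v hv => by
    obtain ⟨-, h1, h2⟩ := Finset.mem_filter.1 hv
    obtain ⟨n, -, h3, h4⟩ := load_fract_bounds (hint v h1) h2
    omega
  -- The degrees on `T` are at least 2 and sum to at most `2 * (fracEdges H x).card ≤ 2 * T.card`,
  -- so all of them equal 2.
  have hsum : ∑ v ∈ T, fracDegree H x v ≤ ∑ v ∈ T, 2 := by
    refine (Finset.sum_le_sum_of_subset (Finset.subset_univ T)).trans ?_
    rw [sum_fracDegree, Finset.sum_const, smul_eq_mul]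
    omega
  have hdegT : ∀ v ∈ T, 2 = fracDegree H x v :=
    (Finset.sum_eq_sum_iff_of_le hdeg2).1 (le_antisymm (Finset.sum_le_sum hdeg2) hsum)
  -- At a vertex of `T` the two fractional parts sum to an integer strictly between 0 and 2, hence
  -- to 1. So `d` has zero load at tight vertices and vanishes by `hd`: every fractional part is
  -- `1/2`.
  set d : Sym2 V → ℝ := fun e => if e ∈ fracEdges H x then Int.fract (x e) - 1 / 2 else 0
    with hd_def
  have hd0 : d = 0 := by
    have hd1 : ∀ e ∉ fracEdges H x, d e = 0 := fun e he => if_neg he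
    refine hd d hd1 fun v hv => ?_
    have h1 : load H d v = load H (fun e => Int.fract (x e)) v - fracDegree H x v * (1 / 2) := by
      rw [load_eq_sum_fracEdges (hsupp hd1), load_eq_sum_fracEdges (H := H) (x := x)
        (d := fun e => Int.fract (x e)) (fun e he => isInteger_iff_fract.1 he), fracDegree,
        ← nsmul_eq_mul, ← Finset.sum_const, ← Finset.sum_sub_distrib]
      exact Finset.sum_congr rfl fun e he => if_pos (Finset.mem_filter.1 he).1
    by_cases hdeg : 0 < fracDegree H x v
    · obtain ⟨n, h2, h3, h4⟩ := load_fract_bounds (hint v hv) hdeg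
      have h5 := hdegT v (by simp [hT, hv, hdeg])
      have h6 : n = 1 := by omega
      rw [h1, h2, ← h5, h6]; norm_num
    · rw [load_eq_sum_fracEdges (hsupp hd1)]
      rw [fracDegree, Finset.card_pos, Finset.not_nonempty_iff_eq_empty] at hdeg
      rw [hdeg, Finset.sum_empty]
  intro e he
  by_cases hi : IsInteger (x e)
  · obtain ⟨n, hn⟩ := hi
    exact ⟨2 * n, by rw [hn]; push_cast; ring⟩
  · have h1 := congrFun hd0 e
    simp only [hd_def, mem_fracEdges.2 ⟨he, hi⟩, if_true, Pi.zero_apply] at h1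
    refine ⟨2 * ⌊x e⌋ + 1, ?_⟩
    have h2 := Int.floor_add_fract (x e)
    push_cast
    linarith

/-- Strong duality for arbitrary optima: `exists_cover_le` is applied with `r` the maximum weight.
-/
theorem IsMinFractionalCover.weight_eq {H : SimpleGraph V} {b : V → ℕ} {w x : Sym2 V → ℝ}
    {y : V → ℝ} (hx : IsMaxFractionalBMatching H b w x) (hy : IsMinFractionalCover H b w y) :
    weight H w x = ∑ i, (b i : ℝ) * y i := by
  obtain ⟨y', hy', h⟩ := exists_cover_le hx.2
  exact le_antisymm (weight_le_cover hx.1 hy.1) ((hy.2 y' hy').trans h)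

/-- No compactness of the dual is needed: a cover whose value is at most the primal optimum is
minimum by weak duality. -/
theorem exists_minFractionalCover (H : SimpleGraph V) (b : V → ℕ) (w : Sym2 V → ℝ) :
    ∃ y, IsMinFractionalCover H b w y := by
  obtain ⟨x, hx, -⟩ := exists_halfIntegral_max H b w
  obtain ⟨y, hy, h⟩ := exists_cover_le hx.2
  exact ⟨y, hy, fun y' hy' => h.trans (weight_le_cover hx.1 hy')⟩

end BMatchingGame

namespace BMatchingGame

/-! ### Trails and cycles in finite graphs -/

section Graph

open SimpleGraph

variable {V : Type*} [Fintype V] {H : SimpleGraph V}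

open scoped Classical in
theorem degree_eq_ncard (H : SimpleGraph V) (v : V) : H.degree v = (H.neighborSet v).ncard := by
  rw [← card_neighborSet_eq_degree, ← Nat.card_eq_fintype_card, Nat.card_coe_set_eq]

/-- A vertex of odd degree is connected to another one. -/
theorem exists_reachable_odd {u : V} (hu : Odd (H.neighborSet u).ncard) :
    ∃ v, v ≠ u ∧ Odd (H.neighborSet v).ncard ∧ H.Reachable u v := by
  classical
  -- Keeping only the component of `u` preserves degrees inside it and makes them zero outside, so
  -- the handshake lemma yields a second odd vertex inside.
  set K := inducedSubgraph H {z | H.Reachable u z} with hK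
  have h1 : ∀ z, H.Reachable u z → K.neighborSet z = H.neighborSet z := fun z hz => by
    ext t
    exact ⟨fun h => h.1, fun h => ⟨h, hz, hz.trans (Adj.reachable h)⟩⟩
  have h2 : ∀ z, ¬ H.Reachable u z → K.neighborSet z = ∅ := fun z hz => by
    ext t
    exact ⟨fun h => hz h.2.1, fun h => h.elim⟩
  obtain ⟨v, hv, hodd⟩ := K.exists_ne_odd_degree_of_exists_odd_degree u (by
    rwa [degree_eq_ncard, h1 u (Reachable.refl u)])
  rw [degree_eq_ncard] at hodd
  by_cases hr : H.Reachable u v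
  · exact ⟨v, hv, h1 v hr ▸ hodd, hr⟩
  · rw [h2 v hr] at hodd
    simp at hodd

/-- If all degrees are even, then every edge lies on a cycle. -/
theorem exists_cycle_of_even (hH : ∀ v, Even (H.neighborSet v).ncard) {v u : V} (h : H.Adj v u) :
    ∃ p : H.Walk v v, p.IsCycle ∧ s(v, u) ∈ p.edges := by
  set K := H.deleteEdges {s(v, u)} with hK
  have hle : K ≤ H := deleteEdges_le _
  have h1 : K.neighborSet v = H.neighborSet v \ {u} := by
    ext t
    have : H.Adj v t → v ≠ t := H.ne_of_adj
    simp [hK]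
    grind
  have hodd : Odd (K.neighborSet v).ncard := by
    rw [h1, Set.ncard_sdiff_singleton_of_mem (show u ∈ H.neighborSet v from h)]
    have h2 : 0 < (H.neighborSet v).ncard := (Set.ncard_pos).2 ⟨u, h⟩
    obtain ⟨k, hk⟩ := hH v
    exact ⟨k - 1, by omega⟩
  obtain ⟨w, hwv, hw, hr⟩ := exists_reachable_odd hodd
  -- Deleting the edge changes the parity only at `v` and `u`; a path in `K` from `u` back to `v`
  -- then closes up with the deleted edge.
  have hwu : w = u := by
    by_contra hne
    have h3 : K.neighborSet w = H.neighborSet w := by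
      ext t
      simp [hK, hwv, hne]
    rw [h3] at hw
    exact Nat.not_odd_iff_even.2 (hH w) hw
  subst hwu
  obtain ⟨q, hq⟩ := hr.symm.exists_isPath
  refine ⟨Walk.cons h (q.mapLe hle), (Walk.cons_isCycle_iff _ _).2 ⟨hq.mapLe hle, ?_⟩, by simp⟩
  intro he
  rw [Walk.edges_mapLe_eq_edges] at he
  have := q.edges_subset_edgeSet he
  simp [hK] at this

/-- A cycle uses exactly two edges at each of its vertices and none elsewhere. -/
theorem even_degree_deleteEdges_cycle (hH : ∀ v, Even (H.neighborSet v).ncard) {v : V}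
    {p : H.Walk v v} (hp : p.IsCycle) (x : V) :
    Even ((H.deleteEdges {e | e ∈ p.edges}).neighborSet x).ncard ∧
      (H.neighborSet x).ncard ≤ ((H.deleteEdges {e | e ∈ p.edges}).neighborSet x).ncard + 2 := by
  have h1 : (H.deleteEdges {e | e ∈ p.edges}).neighborSet x =
      H.neighborSet x \ p.toSubgraph.neighborSet x := by
    ext t
    rw [mem_neighborSet, deleteEdges_adj, Set.mem_sdiff, mem_neighborSet,
      Subgraph.mem_neighborSet, Set.mem_ofPred_eq, ← Walk.mem_edges_toSubgraph,
      Subgraph.mem_edgeSet]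
  have h2 : p.toSubgraph.neighborSet x ⊆ H.neighborSet x := p.toSubgraph.neighborSet_subset x
  rw [h1, Set.ncard_sdiff h2]
  have h3 := Set.ncard_le_ncard h2
  have h4 := hH x
  by_cases hx : x ∈ p.support
  · rw [hp.ncard_neighborSet_toSubgraph_eq_two hx] at h3 ⊢
    obtain ⟨k, hk⟩ := h4
    exact ⟨⟨k - 1, by omega⟩, by omega⟩
  · have h5 : p.toSubgraph.neighborSet x = ∅ := by
      ext t
      refine ⟨fun h => hx ?_, fun h => h.elim⟩
      exact p.mem_verts_toSubgraph.1 (p.toSubgraph.edge_vert h)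
    rw [h5, Set.ncard_empty]
    exact ⟨by simpa using h4, by omega⟩

/-- If all degrees are even and some degree exceeds two, there is a closed trail of even length. -/
theorem exists_even_closed_trail (hH : ∀ v, Even (H.neighborSet v).ncard) {v : V}
    (hv : 2 < (H.neighborSet v).ncard) :
    ∃ p : H.Walk v v, p.IsTrail ∧ 0 < p.length ∧ Even p.length := by
  obtain ⟨u, hu⟩ := (Set.ncard_pos).1 (pos_of_gt hv)
  obtain ⟨p, hp, -⟩ := exists_cycle_of_even hH hu
  have hp3 := hp.three_le_length
  rcases Nat.even_or_odd p.length with he | ho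
  · exact ⟨p, hp.isTrail, by omega, he⟩
  -- Since the degree of `v` exceeds 2, an edge at `v` survives the removal of `p`, and with it a
  -- second cycle through `v`. If both cycles are odd, their concatenation is an even closed trail.
  have hK := even_degree_deleteEdges_cycle hH hp
  have hle : H.deleteEdges {e | e ∈ p.edges} ≤ H := deleteEdges_le _
  obtain ⟨u', hu'⟩ := (Set.ncard_pos).1
    (show 0 < ((H.deleteEdges {e | e ∈ p.edges}).neighborSet v).ncard by
      have := (hK v).2
      omega)
  obtain ⟨q, hq, -⟩ := exists_cycle_of_even (fun x => (hK x).1) hu'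
  rcases Nat.even_or_odd q.length with he | ho'
  · exact ⟨q.mapLe hle, hq.isTrail.mapLe hle, by
      have := hq.three_le_length
      rw [Walk.length_mapLe]; omega, by rwa [Walk.length_mapLe]⟩
  refine ⟨p.append (q.mapLe hle), ⟨?_⟩, by rw [Walk.length_append]; omega, by
    rw [Walk.length_append, Walk.length_mapLe]; exact ho.add_odd ho'⟩
  rw [Walk.edges_append, Walk.edges_mapLe_eq_edges]
  refine List.nodup_append.2 ⟨hp.isTrail.edges_nodup, hq.isTrail.edges_nodup, ?_⟩
  rintro e he e' he' rfl
  have := q.edges_subset_edgeSet he'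
  rw [edgeSet_deleteEdges] at this
  exact this.2 he

/-- In a finite graph there is a nonempty trail that joins two distinct vertices of odd degree or
is closed of even length, or else all degrees are at most two, all cycles are odd and they cover
all edges. -/
theorem exists_trail_or_odd_cycles (H : SimpleGraph V) :
    (∃ (u v : V) (p : H.Walk u v), p.IsTrail ∧ 0 < p.length ∧
      ((u ≠ v ∧ Odd (H.neighborSet u).ncard ∧ Odd (H.neighborSet v).ncard) ∨
        (u = v ∧ Even p.length))) ∨
    ((∀ v, (H.neighborSet v).ncard ≤ 2) ∧
      (∀ (v : V) (p : H.Walk v v), p.IsCycle → Odd p.length) ∧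
      ∀ e ∈ H.edgeSet, ∃ (v : V) (p : H.Walk v v), p.IsCycle ∧ e ∈ p.edges) := by
  by_cases h1 : ∃ u, Odd (H.neighborSet u).ncard
  · left
    obtain ⟨u, hu⟩ := h1
    obtain ⟨v, hvu, hv, hr⟩ := exists_reachable_odd hu
    obtain ⟨p, hp⟩ := hr.exists_isPath
    refine ⟨u, v, p, hp.isTrail, ?_, Or.inl ⟨hvu.symm, hu, hv⟩⟩
    by_contra h0
    exact hvu (Walk.eq_of_length_eq_zero (Nat.eq_zero_of_not_pos h0)).symm
  · simp only [not_exists, Nat.not_odd_iff_even] at h1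
    by_cases h2 : ∃ v, 2 < (H.neighborSet v).ncard
    · left
      obtain ⟨v, hv⟩ := h2
      obtain ⟨p, hp, h0, he⟩ := exists_even_closed_trail h1 hv
      exact ⟨v, v, p, hp, h0, Or.inr ⟨rfl, he⟩⟩
    by_cases h3 : ∃ (v : V) (p : H.Walk v v), p.IsCycle ∧ Even p.length
    · left
      obtain ⟨v, p, hp, he⟩ := h3
      exact ⟨v, v, p, hp.isTrail, by have := hp.three_le_length; omega, Or.inr ⟨rfl, he⟩⟩
    right
    refine ⟨fun v => not_lt.1 fun h => h2 ⟨v, h⟩, fun v p hp => ?_, fun e he => ?_⟩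
    · rw [← Nat.not_even_iff_odd]
      exact fun h => h3 ⟨v, p, hp, h⟩
    · induction e with
      | _ v u =>
        obtain ⟨p, hp, h⟩ := exists_cycle_of_even h1 he
        exact ⟨v, p, hp, h⟩

/-- The cycle already uses two edges at `x`, so there is no room for another. Consequently a cycle
fills its whole component. -/
theorem mem_edges_of_degree_le_two (hH : ∀ v, (H.neighborSet v).ncard ≤ 2) {v : V}
    {p : H.Walk v v} (hp : p.IsCycle) {x y : V} (hx : x ∈ p.support) (h : H.Adj x y) :
    s(x, y) ∈ p.edges := by
  have h1 : p.toSubgraph.neighborSet x = H.neighborSet x :=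
    Set.eq_of_subset_of_ncard_le (p.toSubgraph.neighborSet_subset x) (by
      rw [hp.ncard_neighborSet_toSubgraph_eq_two hx]; exact hH x)
  have h2 : y ∈ p.toSubgraph.neighborSet x := by rw [h1]; exact h
  rw [← Walk.mem_edges_toSubgraph]
  exact h2

theorem mem_support_of_degree_le_two (hH : ∀ v, (H.neighborSet v).ncard ≤ 2) {v : V}
    {p : H.Walk v v} (hp : p.IsCycle) {x y : V} (hx : x ∈ p.support) (h : H.Reachable x y) :
    y ∈ p.support := by
  obtain ⟨q⟩ := h
  induction q with
  | nil => exact hx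
  | cons h _ ih => exact ih (p.snd_mem_support_of_mem_edges (mem_edges_of_degree_le_two hH hp hx h))

/-- In a graph with degrees at most two, cycles with a common vertex have the same edges. -/
theorem edges_subset_of_degree_le_two (hH : ∀ v, (H.neighborSet v).ncard ≤ 2) {v u : V}
    {p : H.Walk v v} {q : H.Walk u u} (hp : p.IsCycle) {z : V} (hzp : z ∈ p.support)
    (hzq : z ∈ q.support) {e : Sym2 V} (he : e ∈ q.edges) : e ∈ p.edges := by
  classical
  induction e with
  | _ x y =>
    have hx : x ∈ q.support := q.fst_mem_support_of_mem_edges he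
    have hr : H.Reachable z x :=
      (q.takeUntil z hzq).reachable.symm.trans (q.takeUntil x hx).reachable
    exact mem_edges_of_degree_le_two hH hp (mem_support_of_degree_le_two hH hp hzp hr)
      (q.edges_subset_edgeSet he)

omit [Fintype V] in
/-- A nonempty walk is determined as a subgraph by its edges. -/
theorem toSubgraph_eq_of_edges {v u v' u' : V} {p : H.Walk v u} {q : H.Walk v' u'}
    (hp : ¬ p.Nil) (hq : ¬ q.Nil) (h : ∀ e, e ∈ p.edges ↔ e ∈ q.edges) :
    p.toSubgraph = q.toSubgraph := by
  refine Subgraph.ext ?_ ?_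
  · ext x
    rw [Walk.mem_verts_toSubgraph, Walk.mem_verts_toSubgraph,
      Walk.mem_support_iff_exists_mem_edges_of_not_nil hp,
      Walk.mem_support_iff_exists_mem_edges_of_not_nil hq]
    simp only [h]
  · ext x y
    rw [← Subgraph.mem_edgeSet, ← Subgraph.mem_edgeSet, Walk.mem_edges_toSubgraph,
      Walk.mem_edges_toSubgraph, h]

end Graph

end BMatchingGame

namespace BMatchingGame

variable {V : Type*} [Fintype V] {G : SimpleGraph V} {b : V → ℕ} {w x : Sym2 V → ℝ}

/-! ### Modifying a half-integral optimum -/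

omit [Fintype V] in
theorem nonIntegralGraph_le : nonIntegralGraph G x ≤ G := fun _ _ h => h.1

omit [Fintype V] in
theorem mem_edgeSet_nonIntegralGraph {e : Sym2 V} :
    e ∈ (nonIntegralGraph G x).edgeSet ↔ e ∈ G.edgeSet ∧ ¬ IsInteger (x e) := by
  induction e with | _ u v => rfl

theorem ncard_neighborSet_nonIntegralGraph (v : V) :
    ((nonIntegralGraph G x).neighborSet v).ncard = fracDegree G x v := by
  classical
  rw [← degree_eq_ncard, ← SimpleGraph.card_incidenceFinset_eq_degree, fracDegree]
  congr 1
  ext e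
  rw [SimpleGraph.mem_incidenceFinset, Finset.mem_filter, mem_fracEdges,
    ← mem_edgeSet_nonIntegralGraph]
  rfl

theorem fract_eq_half {r : ℝ} (h : IsInteger (2 * r)) (hr : ¬ IsInteger r) :
    Int.fract r = 1 / 2 := by
  obtain ⟨n, hn⟩ := h
  have h1 := Int.floor_add_fract r
  have h2 := Int.fract_lt_one r
  have h3 : 0 < Int.fract r := (Int.fract_nonneg r).lt_of_ne' (mt isInteger_iff_fract.2 hr)
  have h4 : 2 * Int.fract r = ((n - 2 * ⌊r⌋ : ℤ) : ℝ) := by push_cast; linarith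
  have h5 : (0 : ℝ) < ((n - 2 * ⌊r⌋ : ℤ) : ℝ) := by linarith
  have h6 : ((n - 2 * ⌊r⌋ : ℤ) : ℝ) < 2 := by linarith
  have h7 : n - 2 * ⌊r⌋ = 1 := by
    have h5' : 0 < n - 2 * ⌊r⌋ := by exact_mod_cast h5
    have h6' : n - 2 * ⌊r⌋ < 2 := by exact_mod_cast h6
    omega
  rw [h7] at h4
  push_cast at h4
  linarith

theorem isInteger_add_half {r s : ℝ} (h : Int.fract r = 1 / 2) (hs : s = 1 / 2 ∨ s = -(1 / 2)) :
    IsInteger (r + s) := by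
  have h1 := Int.floor_add_fract r
  rcases hs with rfl | rfl
  · exact ⟨⌊r⌋ + 1, by push_cast; linarith⟩
  · exact ⟨⌊r⌋, by linarith⟩

theorem half_le_of_fract {r : ℝ} (h : Int.fract r = 1 / 2) (h0 : 0 ≤ r) : 1 / 2 ≤ r := by
  have h1 := Int.floor_add_fract r
  have h2 : (0 : ℝ) ≤ ⌊r⌋ := by exact_mod_cast Int.floor_nonneg.2 h0
  linarith

omit [Fintype V] in
theorem IsHalfIntegral.fract_of_mem (hx : IsHalfIntegral G x) {e : Sym2 V}
    (he : e ∈ (nonIntegralGraph G x).edgeSet) : Int.fract (x e) = 1 / 2 := by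
  rw [mem_edgeSet_nonIntegralGraph] at he
  exact fract_eq_half (hx e he.1) he.2

/-- At a vertex of odd degree among the non-integral edges there is room for another `1/2`. -/
theorem load_add_half_le (hx : IsHalfIntegral G x) {v : V}
    (hodd : Odd ((nonIntegralGraph G x).neighborSet v).ncard) (hle : load G x v ≤ b v) :
    load G x v + 1 / 2 ≤ b v := by
  classical
  rw [ncard_neighborSet_nonIntegralGraph] at hodd
  obtain ⟨k, hk⟩ := hodd
  have h1 : load G (fun e => Int.fract (x e)) v = fracDegree G x v * (1 / 2) := by
    rw [load_eq_sum_fracEdges (H := G) (x := x) (d := fun e => Int.fract (x e))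
      (fun e he => isInteger_iff_fract.1 he), fracDegree, ← nsmul_eq_mul, ← Finset.sum_const]
    refine Finset.sum_congr rfl fun e he => hx.fract_of_mem ?_
    rw [mem_edgeSet_nonIntegralGraph, ← mem_fracEdges]
    exact (Finset.mem_filter.1 he).1
  -- With `2 * k + 1` fractional parts of `1/2`, the load is an integer plus `1/2`, hence at least
  -- `1/2` below the integer `b v`.
  have h2 : load G x v = ((∑ e ∈ G.edgeFinset with v ∈ e, ⌊x e⌋ : ℤ) : ℝ) + k + 1 / 2 := by
    have h3 : load G x v = load G (fun e => (⌊x e⌋ : ℝ)) v + load G (fun e => Int.fract (x e)) v := by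
      rw [← load_add]
      simp only [Int.floor_add_fract]
    rw [h3, h1, hk, load]
    push_cast
    ring
  rw [h2] at hle ⊢
  have h4 : (∑ e ∈ G.edgeFinset with v ∈ e, ⌊x e⌋) + (k : ℤ) < b v := by
    have : (((∑ e ∈ G.edgeFinset with v ∈ e, ⌊x e⌋) + (k : ℤ) : ℤ) : ℝ) < ((b v : ℤ) : ℝ) := by
      push_cast at hle ⊢; linarith
    exact_mod_cast this
  have h5 : (((∑ e ∈ G.edgeFinset with v ∈ e, ⌊x e⌋) + (k : ℤ) + 1 : ℤ) : ℝ) ≤ ((b v : ℤ) : ℝ) := by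
    exact_mod_cast h4
  push_cast at h5 ⊢
  linarith

omit [Fintype V] in
theorem altVec_half {s : ℝ} (hs : s = 1 / 2 ∨ s = -(1 / 2)) {T : List (Sym2 V)} {e : Sym2 V}
    (he : e ∈ T) : altVec s T e = 1 / 2 ∨ altVec s T e = -(1 / 2) := by
  rcases altVec_of_mem s he with h | h <;> rcases hs with rfl | rfl
  · exact Or.inl h
  · exact Or.inr h
  · exact Or.inr h
  · exact Or.inl (by rw [h, neg_neg])

omit [Fintype V] in
theorem isHalfIntegral_add_altVec (hx : IsHalfIntegral G x) {s : ℝ}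
    (hs : s = 1 / 2 ∨ s = -(1 / 2)) (T : List (Sym2 V)) :
    IsHalfIntegral G fun e => x e + altVec s T e := by
  intro e he
  obtain ⟨n, hn⟩ := hx e he
  by_cases hT : e ∈ T
  · rcases altVec_half hs hT with h | h
    · exact ⟨n + 1, by dsimp only; rw [h]; push_cast; linarith⟩
    · exact ⟨n - 1, by dsimp only; rw [h]; push_cast; linarith⟩
  · exact ⟨n, by dsimp only; rw [altVec_of_notMem s hT, add_zero, hn]⟩

omit [Fintype V] in
/-- Alternating along a list of non-integral edges makes them integral. -/
theorem isInteger_add_altVec_iff (hx : IsHalfIntegral G x) {s : ℝ}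
    (hs : s = 1 / 2 ∨ s = -(1 / 2)) {T : List (Sym2 V)}
    (hT : ∀ e ∈ T, e ∈ (nonIntegralGraph G x).edgeSet) (e : Sym2 V) :
    IsInteger (x e + altVec s T e) ↔ IsInteger (x e) ∨ e ∈ T := by
  by_cases h : e ∈ T
  · simp only [h, or_true, iff_true]
    exact isInteger_add_half (hx.fract_of_mem (hT e h)) (altVec_half hs h)
  · rw [altVec_of_notMem s h, add_zero]
    simp [h]

omit [Fintype V] in
theorem add_altVec_nonneg (hx0 : ∀ e ∈ G.edgeSet, 0 ≤ x e) (hx : IsHalfIntegral G x) {s : ℝ}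
    (hs : s = 1 / 2 ∨ s = -(1 / 2)) {T : List (Sym2 V)}
    (hT : ∀ e ∈ T, e ∈ (nonIntegralGraph G x).edgeSet) {e : Sym2 V} (he : e ∈ G.edgeSet) :
    0 ≤ x e + altVec s T e := by
  by_cases h : e ∈ T
  · have h1 := half_le_of_fract (hx.fract_of_mem (hT e h)) (hx0 e he)
    rcases altVec_half hs h with h | h <;> rw [h] <;> linarith
  · rw [altVec_of_notMem s h, add_zero]
    exact hx0 e he

/-- Loads move only at the ends of the trail: by `1/2` in absolute value at distinct ends, where odd
degree leaves room, and not at all on a closed even trail. Both signs of `s` are allowed, as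
`isMax_add_altVec` needs. -/
theorem isFractionalBMatching_add_altVec (hx : IsFractionalBMatching G b x)
    (hh : IsHalfIntegral G x) {s : ℝ} (hs : s = 1 / 2 ∨ s = -(1 / 2)) {u v : V}
    {p : (nonIntegralGraph G x).Walk u v} (hp : p.IsTrail)
    (huv : (u ≠ v ∧ Odd ((nonIntegralGraph G x).neighborSet u).ncard ∧
      Odd ((nonIntegralGraph G x).neighborSet v).ncard) ∨ (u = v ∧ Even p.length)) :
    IsFractionalBMatching G b fun e => x e + altVec s p.edges e := by
  classical
  refine ⟨fun i => ?_, fun e he =>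
    add_altVec_nonneg hx.2 hh hs (fun e he => p.edges_subset_edgeSet he) he⟩
  rw [load_add, load_altVec nonIntegralGraph_le s p hp]
  have h1 := hx.1 i
  rcases huv with ⟨hne, hu, hv⟩ | ⟨rfl, he⟩
  · have hs2 : s ≤ 1 / 2 ∧ -(1 / 2) ≤ s := by rcases hs with rfl | rfl <;> norm_num
    by_cases hiu : u = i
    · subst hiu
      have := load_add_half_le hh hu h1
      rw [if_pos rfl, if_neg hne.symm]
      linarith
    · by_cases hiv : v = i
      · subst hiv
        have := load_add_half_le hh hv h1
        rw [if_neg hiu, if_pos rfl]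
        rcases neg_one_pow_eq_or ℝ p.length with h | h <;> rw [h] <;> linarith
      · rw [if_neg hiu, if_neg hiv]
        linarith
  · rw [he.neg_one_pow]
    linarith

/-- An alternating operation leads from an optimum to an optimum. -/
theorem isMax_add_altVec (hx : IsMaxFractionalBMatching G b w x)
    (hh : IsHalfIntegral G x) {s : ℝ} (hs : s = 1 / 2 ∨ s = -(1 / 2)) {u v : V}
    {p : (nonIntegralGraph G x).Walk u v} (hp : p.IsTrail)
    (huv : (u ≠ v ∧ Odd ((nonIntegralGraph G x).neighborSet u).ncard ∧
      Odd ((nonIntegralGraph G x).neighborSet v).ncard) ∨ (u = v ∧ Even p.length)) :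
    IsMaxFractionalBMatching G b w fun e => x e + altVec s p.edges e := by
  have hs' : -s = 1 / 2 ∨ -s = -(1 / 2) := by rcases hs with rfl | rfl <;> simp
  have h1 := isFractionalBMatching_add_altVec hx.1 hh hs hp huv
  -- The opposite alternation is feasible too and cannot gain weight, so the original one cannot
  -- lose any.
  have h2 := isFractionalBMatching_add_altVec hx.1 hh hs' hp huv
  refine ⟨h1, fun x' hx' => (hx.2 x' hx').trans ?_⟩
  have h3 := hx.2 _ h2
  simp only [altVec_neg] at h3
  rw [weight_add, weight_mul] at h3
  rw [weight_add]
  linarith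

/-- If no alternating operation is possible, then the non-integral edges form disjoint odd
cycles. -/
theorem exists_nonIntegralCycles
    (h2 : ∀ v, ((nonIntegralGraph G x).neighborSet v).ncard ≤ 2)
    (hodd : ∀ (v : V) (p : (nonIntegralGraph G x).Walk v v), p.IsCycle → Odd p.length)
    (hcov : ∀ e ∈ (nonIntegralGraph G x).edgeSet,
      ∃ (v : V) (p : (nonIntegralGraph G x).Walk v v), p.IsCycle ∧ e ∈ p.edges) :
    ∃ 𝒞 : Set G.Subgraph, NonIntegralCycles G x 𝒞 := by
  have hle : nonIntegralGraph G x ≤ G := nonIntegralGraph_le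
  refine ⟨{C | ∃ (v : V) (p : (nonIntegralGraph G x).Walk v v), p.IsCycle ∧
    C = (p.mapLe hle).toSubgraph}, ⟨?_, ?_, fun e he => ?_⟩⟩
  · rintro C ⟨v, p, hp, rfl⟩
    exact ⟨v, p.mapLe hle, hp.mapLe hle, by
      rw [SimpleGraph.Walk.length_mapLe]; exact hodd v p hp, rfl⟩
  · rintro C ⟨v, p, hp, rfl⟩ D ⟨u, q, hq, rfl⟩ hne
    rw [Set.disjoint_left]
    intro z hzp hzq
    rw [SimpleGraph.Walk.mem_verts_toSubgraph, SimpleGraph.Walk.support_mapLe_eq_support]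
      at hzp hzq
    refine hne (toSubgraph_eq_of_edges (hp.mapLe hle).not_nil (hq.mapLe hle).not_nil fun e => ?_)
    simp only [SimpleGraph.Walk.edges_mapLe_eq_edges]
    exact ⟨edges_subset_of_degree_le_two h2 hq hzq hzp, edges_subset_of_degree_le_two h2 hp hzp hzq⟩
  · constructor
    · intro hi
      obtain ⟨v, p, hp, hep⟩ := hcov e (mem_edgeSet_nonIntegralGraph.2 ⟨he, hi⟩)
      refine ⟨_, ⟨v, p, hp, rfl⟩, ?_⟩
      rwa [SimpleGraph.Walk.mem_edges_toSubgraph, SimpleGraph.Walk.edges_mapLe_eq_edges]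
    · rintro ⟨C, ⟨v, p, hp, rfl⟩, hC⟩
      rw [SimpleGraph.Walk.mem_edges_toSubgraph, SimpleGraph.Walk.edges_mapLe_eq_edges] at hC
      exact (mem_edgeSet_nonIntegralGraph.1 (p.edges_subset_edgeSet hC)).2

/-- Induction on the number of non-integral edges: an alternation makes all edges of its nonempty
trail integral and touches no others. -/
theorem exists_modification (hx : IsMaxFractionalBMatching G b w x) (hh : IsHalfIntegral G x) :
    ∃ (x' : Sym2 V → ℝ) (𝒞 : Set G.Subgraph), Relation.ReflTransGen (ModifyStep G) x x' ∧
      IsMaxFractionalBMatching G b w x' ∧ IsHalfIntegral G x' ∧ NonIntegralCycles G x' 𝒞 := by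
  induction hn : (fracEdges G x).card using Nat.strong_induction_on generalizing x with
  | _ n ih =>
    rcases exists_trail_or_odd_cycles (nonIntegralGraph G x) with
      ⟨u, v, p, hp, hpos, huv⟩ | ⟨h2, hodd, hcov⟩
    · have hs : (-(1 / 2) : ℝ) = 1 / 2 ∨ (-(1 / 2) : ℝ) = -(1 / 2) := Or.inr rfl
      have hT : ∀ e ∈ p.edges, e ∈ (nonIntegralGraph G x).edgeSet :=
        fun e he => p.edges_subset_edgeSet he
      have hstep : ModifyStep G x fun e => x e + altVec (-(1 / 2)) p.edges e :=
        ⟨u, v, p, hp, huv, (alternate_eq_add x p.edges).symm⟩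
      have hlt : (fracEdges G fun e => x e + altVec (-(1 / 2)) p.edges e).card < n := by
        rw [← hn]
        refine Finset.card_lt_card ((Finset.ssubset_iff_of_subset fun e he => ?_).2 ?_)
        · rw [mem_fracEdges, isInteger_add_altVec_iff hh hs hT, not_or] at he
          exact mem_fracEdges.2 ⟨he.1, he.2.1⟩
        · obtain ⟨e, he⟩ := List.exists_mem_of_length_pos
            (show 0 < p.edges.length by rwa [SimpleGraph.Walk.length_edges])
          refine ⟨e, mem_fracEdges.2 (mem_edgeSet_nonIntegralGraph.1 (hT e he)), fun h => ?_⟩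
          rw [mem_fracEdges, isInteger_add_altVec_iff hh hs hT] at h
          exact h.2 (Or.inr he)
      obtain ⟨x', 𝒞, h1, h2⟩ := ih _ hlt (isMax_add_altVec hx hh hs hp huv)
        (isHalfIntegral_add_altVec hh hs _) rfl
      exact ⟨x', 𝒞, Relation.ReflTransGen.head hstep h1, h2⟩
    · obtain ⟨𝒞, h𝒞⟩ := exists_nonIntegralCycles h2 hodd hcov
      exact ⟨x, 𝒞, Relation.ReflTransGen.refl, hx, hh, h𝒞⟩

end BMatchingGame

namespace BMatchingGame

variable {V : Type*} [Fintype V] {G : SimpleGraph V} {b : V → ℕ} {w x : Sym2 V → ℝ} {y : V → ℝ}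
  {𝒞 : Set G.Subgraph}

/-! ### Rounding the odd cycles -/

omit [Fintype V] in
theorem cycleLength_toSubgraph {v : V} {p : G.Walk v v} (hp : p.IsCycle) :
    cycleLength p.toSubgraph = p.length := by
  classical
  have h : p.toSubgraph.edgeSet = (p.edges.toFinset : Set (Sym2 V)) := by
    ext e; simp
  rw [cycleLength, h, Set.ncard_coe_finset, List.toFinset_card_of_nodup hp.isTrail.edges_nodup,
    SimpleGraph.Walk.length_edges]

omit [Fintype V] in
theorem ncard_verts_toSubgraph {v : V} {p : G.Walk v v} (hp : p.IsCycle) :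
    p.toSubgraph.verts.ncard = p.length := by
  classical
  -- The base vertex occurs at both ends of `support`; the tail lists every vertex once.
  have h : p.toSubgraph.verts = (p.support.tail.toFinset : Set V) := by
    ext u
    rw [SimpleGraph.Walk.mem_verts_toSubgraph, List.coe_toFinset, Set.mem_ofPred_eq]
    refine ⟨fun hu => ?_, List.mem_of_mem_tail⟩
    rw [SimpleGraph.Walk.mem_support_iff] at hu
    rcases hu with rfl | hu
    · exact SimpleGraph.Walk.end_mem_tail_support hp.not_nil
    · exact hu
  rw [h, Set.ncard_coe_finset, List.toFinset_card_of_nodup hp.support_nodup]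
  simp

omit [Fintype V] in
theorem IsOddCycle.three_le_cycleLength {C : G.Subgraph} (hC : IsOddCycle C) :
    3 ≤ cycleLength C := by
  obtain ⟨v, p, hp, -, rfl⟩ := hC
  rw [cycleLength_toSubgraph hp]
  exact hp.three_le_length

open scoped Classical in
/-- An odd cycle can be traversed from a vertex where `y` is at most its average over the cycle. -/
theorem IsOddCycle.exists_walk {C : G.Subgraph} (hC : IsOddCycle C) (y : V → ℝ) :
    ∃ (v : V) (p : G.Walk v v), p.IsTrail ∧ Odd p.length ∧ (∀ e, e ∈ p.edges ↔ e ∈ C.edgeSet) ∧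
      y v ≤ ∑ i, if i ∈ C.verts then y i / cycleLength C else 0 := by
  have h3 := hC.three_le_cycleLength
  obtain ⟨v, p, hp, hodd, rfl⟩ := hC
  obtain ⟨u, hu, hmin⟩ := Finset.exists_min_image p.support.toFinset y ⟨v, by simp⟩
  have hu' : u ∈ p.support := by simpa using hu
  refine ⟨u, p.rotate u hu', hp.isTrail.rotate hu', by simpa using hodd, fun e => ?_, ?_⟩
  · rw [(p.rotate_edges u hu').mem_iff, SimpleGraph.Walk.mem_edges_toSubgraph]
  · have hl : (0 : ℝ) < cycleLength p.toSubgraph := by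
      exact_mod_cast (show 0 < cycleLength p.toSubgraph by omega)
    have hcard : (p.support.toFinset.card : ℝ) = cycleLength p.toSubgraph := by
      rw [cycleLength_toSubgraph hp, ← ncard_verts_toSubgraph hp, ← Set.ncard_coe_finset]
      congr 2
      ext i; simp
    have h1 : (∑ i, if i ∈ p.toSubgraph.verts then y i / cycleLength p.toSubgraph else 0) =
        (∑ i ∈ p.support.toFinset, y i) / cycleLength p.toSubgraph := by
      rw [← Finset.sum_filter, ← Finset.sum_div]
      congr 2
      ext i; simp
    rw [h1, le_div_iff₀ hl, mul_comm, ← hcard, ← nsmul_eq_mul]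
    exact Finset.card_nsmul_le_sum _ _ _ hmin

open scoped Classical in
/-- The amount `y i / l_C` that a vertex `i` on a cycle `C` loses in the allocation. -/
noncomputable def cycleShare (y : V → ℝ) (𝒞 : Set G.Subgraph) (i : V) : ℝ :=
  if h : ∃ C ∈ 𝒞, i ∈ C.verts then y i / cycleLength h.choose else 0

omit [Fintype V] in
theorem choose_eq (hdis : ∀ C ∈ 𝒞, ∀ D ∈ 𝒞, C ≠ D → Disjoint C.verts D.verts) {i : V}
    (h : ∃ C ∈ 𝒞, i ∈ C.verts) {C : G.Subgraph} (hC : C ∈ 𝒞) (hi : i ∈ C.verts) :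
    h.choose = C := by
  by_contra hne
  exact Set.disjoint_left.1 (hdis _ h.choose_spec.1 _ hC hne) h.choose_spec.2 hi

theorem cycleShare_of_mem (hdis : ∀ C ∈ 𝒞, ∀ D ∈ 𝒞, C ≠ D → Disjoint C.verts D.verts) {i : V}
    {C : G.Subgraph} (hC : C ∈ 𝒞) (hi : i ∈ C.verts) :
    cycleShare y 𝒞 i = y i / cycleLength C := by
  have h : ∃ C ∈ 𝒞, i ∈ C.verts := ⟨C, hC, hi⟩
  rw [cycleShare, dif_pos h, choose_eq hdis h hC hi]

theorem cycleShare_of_notMem {i : V} (h : ¬ ∃ C ∈ 𝒞, i ∈ C.verts) : cycleShare y 𝒞 i = 0 := by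
  rw [cycleShare, dif_neg h]

-- Splits off one cycle, for the induction on the number of cycles.
open scoped Classical in
theorem cycleShare_eq_add (hdis : ∀ C ∈ 𝒞, ∀ D ∈ 𝒞, C ≠ D → Disjoint C.verts D.verts)
    {C : G.Subgraph} (hC : C ∈ 𝒞) (i : V) :
    cycleShare y 𝒞 i =
      cycleShare y (𝒞 \ {C}) i + if i ∈ C.verts then y i / cycleLength C else 0 := by
  by_cases hi : i ∈ C.verts
  · rw [if_pos hi, cycleShare_of_mem hdis hC hi, cycleShare_of_notMem, zero_add]
    rintro ⟨D, ⟨hD, hne⟩, hiD⟩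
    exact Set.disjoint_left.1 (hdis D hD C hC hne) hiD hi
  · rw [if_neg hi, add_zero]
    by_cases h : ∃ D ∈ 𝒞, i ∈ D.verts
    · obtain ⟨D, hD, hiD⟩ := h
      have hne : D ≠ C := by rintro rfl; exact hi hiD
      rw [cycleShare_of_mem hdis hD hiD, cycleShare_of_mem
        (fun A hA B hB => hdis A hA.1 B hB.1) (show D ∈ 𝒞 \ {C} from ⟨hD, hne⟩) hiD]
    · rw [cycleShare_of_notMem h, cycleShare_of_notMem]
      rintro ⟨D, hD, hiD⟩
      exact h ⟨D, hD.1, hiD⟩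

omit [Fintype V] in
theorem NonIntegralCycles.mem_edgeSet (h𝒞 : NonIntegralCycles G x 𝒞) {C : G.Subgraph} (hC : C ∈ 𝒞)
    {e : Sym2 V} (he : e ∈ C.edgeSet) : e ∈ (nonIntegralGraph G x).edgeSet := by
  have heG : e ∈ G.edgeSet := C.edgeSet_subset he
  exact mem_edgeSet_nonIntegralGraph.2 ⟨heG, (h𝒞.edges e heG).2 ⟨C, hC, he⟩⟩

/-- Rounding the cycles of non-integral edges one by one yields a `b`-matching. -/
theorem exists_bMatching_of_nonIntegralCycles (hx : IsFractionalBMatching G b x)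
    (hh : IsHalfIntegral G x) (h𝒞 : NonIntegralCycles G x 𝒞)
    (htight : ∀ e ∈ G.edgeSet, ¬ IsInteger (x e) → w e = endSum y e) :
    ∃ z : Sym2 V → ℤ, IsBMatching G b z ∧
      weight G w x - ∑ i, cycleShare y 𝒞 i ≤ weight G w fun e => (z e : ℝ) := by
  classical
  -- Rounding a cycle may destroy optimality, so the induction carries only feasibility and
  -- `htight`; the latter survives because no edge becomes non-integral.
  induction hn : 𝒞.ncard generalizing 𝒞 x with
  | zero =>
    have h0 : 𝒞 = ∅ := (Set.ncard_eq_zero (Set.toFinite 𝒞)).1 hn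
    subst h0
    have hint : ∀ e ∈ G.edgeSet, ((⌊x e⌋ : ℤ) : ℝ) = x e := fun e he => by
      have h1 : IsInteger (x e) := by
        by_contra h
        obtain ⟨C, hC, -⟩ := (h𝒞.edges e he).1 h
        exact hC
      obtain ⟨n, hn⟩ := h1
      rw [hn, Int.floor_intCast]
    refine ⟨fun e => ⌊x e⌋, ⟨fun v => ?_, fun e he => ?_⟩, ?_⟩
    · refine le_trans (le_of_eq ?_) (hx.1 v)
      exact Finset.sum_congr rfl fun e he => hint e (by simpa using (Finset.mem_filter.1 he).1)
    · dsimp only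
      rw [hint e he]
      exact hx.2 e he
    · have h1 : ∀ i, cycleShare y (∅ : Set G.Subgraph) i = 0 := fun i =>
        cycleShare_of_notMem (by simp)
      simp only [h1, Finset.sum_const_zero, sub_zero]
      refine le_of_eq (Finset.sum_congr rfl fun e he => ?_)
      have h2 := hint e (by simpa using he)
      simp only [h2]
  | succ n ih =>
    obtain ⟨C, hC⟩ := Set.nonempty_of_ncard_ne_zero (show 𝒞.ncard ≠ 0 by omega)
    obtain ⟨v, p, hp, hodd, hpC, hy⟩ := (h𝒞.oddCycle C hC).exists_walk y
    have hs : (-(1 / 2) : ℝ) = 1 / 2 ∨ (-(1 / 2) : ℝ) = -(1 / 2) := Or.inr rfl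
    have hT : ∀ e ∈ p.edges, e ∈ (nonIntegralGraph G x).edgeSet := fun e he =>
      h𝒞.mem_edgeSet hC ((hpC e).1 he)
    set x' : Sym2 V → ℝ := fun e => x e + altVec (-(1 / 2)) p.edges e with hx'
    have hint : ∀ e, IsInteger (x' e) ↔ IsInteger (x e) ∨ e ∈ p.edges :=
      isInteger_add_altVec_iff hh hs hT
    -- Around an odd closed trail beginning with `-1/2`, the load of `v` drops by 1 and all others
    -- stay.
    have hfeas : IsFractionalBMatching G b x' := by
      refine ⟨fun i => ?_, fun e he => add_altVec_nonneg hx.2 hh hs hT he⟩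
      rw [hx', load_add, load_altVec le_rfl _ p hp, hodd.neg_one_pow]
      have := hx.1 i
      split_ifs <;> linarith
    have hcyc : NonIntegralCycles G x' (𝒞 \ {C}) := by
      refine ⟨fun D hD => h𝒞.oddCycle D hD.1, fun A hA B hB => h𝒞.disjoint A hA.1 B hB.1,
        fun e he => ?_⟩
      rw [hint, not_or, hpC, h𝒞.edges e he]
      constructor
      · rintro ⟨⟨D, hD, heD⟩, heC⟩
        exact ⟨D, ⟨hD, by rintro rfl; exact heC heD⟩, heD⟩
      · rintro ⟨D, ⟨hD, hne⟩, heD⟩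
        refine ⟨⟨D, hD, heD⟩, fun heC => ?_⟩
        clear he
        induction e with
        | _ u t =>
          exact Set.disjoint_left.1 (h𝒞.disjoint D hD C hC hne) (D.edge_vert heD)
            (C.edge_vert heC)
    obtain ⟨z, hz, hle⟩ := ih hfeas (isHalfIntegral_add_altVec hh hs _) hcyc
      (fun e he h => htight e he fun h' => h ((hint e).2 (Or.inl h')))
      (by rw [Set.ncard_sdiff_singleton_of_mem hC]; omega)
    refine ⟨z, hz, le_trans ?_ hle⟩
    -- On the cycle `w` may be replaced by `endSum y`, and then the sum telescopes.
    have h1 : weight G w (altVec (-(1 / 2)) p.edges) = -y v := by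
      have h2 : weight G w (altVec (-(1 / 2)) p.edges) =
          weight G (endSum y) (altVec (-(1 / 2)) p.edges) := by
        refine Finset.sum_congr rfl fun e _ => ?_
        by_cases he : e ∈ p.edges
        · have h3 := mem_edgeSet_nonIntegralGraph.1 (hT e he)
          rw [htight e h3.1 h3.2]
        · rw [altVec_of_notMem _ he, mul_zero, mul_zero]
      rw [h2, weight_endSum_altVec le_rfl y _ p hp, hodd.neg_one_pow]
      ring
    have h2 : ∑ i, cycleShare y 𝒞 i = ∑ i, cycleShare y (𝒞 \ {C}) i +
        ∑ i, if i ∈ C.verts then y i / cycleLength C else 0 := by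
      rw [← Finset.sum_add_distrib]
      exact Finset.sum_congr rfl fun i _ => cycleShare_eq_add h𝒞.disjoint hC i
    rw [hx', weight_add, h1, h2]
    linarith

/-! ### The approximate core -/

/-- A non-integral edge at `i` carries at least `1/2`, so `b i` is positive. This replaces a global
assumption on the capacities in the first factor. -/
theorem one_le_capacity (hx : IsFractionalBMatching G b x) (hh : IsHalfIntegral G x)
    (h𝒞 : NonIntegralCycles G x 𝒞) {C : G.Subgraph} (hC : C ∈ 𝒞) {i : V} (hi : i ∈ C.verts) :
    1 ≤ b i := by
  have h : ∃ e ∈ C.edgeSet, i ∈ e := by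
    obtain ⟨v, p, hp, -, rfl⟩ := h𝒞.oddCycle C hC
    rw [SimpleGraph.Walk.mem_verts_toSubgraph,
      SimpleGraph.Walk.mem_support_iff_exists_mem_edges_of_not_nil hp.not_nil] at hi
    obtain ⟨e, he, hie⟩ := hi
    exact ⟨e, by simpa using he, hie⟩
  obtain ⟨e, he, hie⟩ := h
  have h1 := h𝒞.mem_edgeSet hC he
  have h2 := (mem_edgeSet_nonIntegralGraph.1 h1).1
  have h3 := half_le_of_fract (hh.fract_of_mem h1) (hx.2 e h2)
  have h4 := (le_load hx.2 h2 hie).trans (hx.1 i)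
  have h5 : (0 : ℝ) < b i := by linarith
  exact_mod_cast h5

/-- The capacity cancels from `(1 / (l_C * b i)) * (b i * y i)`; `one_le_capacity` rules out
division by zero. -/
theorem allocation_eq_sub (hx : IsFractionalBMatching G b x) (hh : IsHalfIntegral G x)
    (h𝒞 : NonIntegralCycles G x 𝒞) (i : V) :
    allocation b y 𝒞 i = b i * y i - cycleShare y 𝒞 i := by
  by_cases h : ∃ C ∈ 𝒞, i ∈ C.verts
  · have hb := one_le_capacity hx hh h𝒞 h.choose_spec.1 h.choose_spec.2
    have hl := (h𝒞.oddCycle _ h.choose_spec.1).three_le_cycleLength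
    have hb' : (b i : ℝ) ≠ 0 := by exact_mod_cast (show b i ≠ 0 by omega)
    have hl' : (cycleLength h.choose : ℝ) ≠ 0 := by
      exact_mod_cast (show cycleLength h.choose ≠ 0 by omega)
    rw [allocation, dif_pos h, cycleShare, dif_pos h]
    field_simp
  · rw [allocation, dif_neg h, cycleShare_of_notMem h, sub_zero]

omit [Fintype V] in
theorem inducedSubgraph_univ (G : SimpleGraph V) : inducedSubgraph G Set.univ = G := by
  ext u v
  simp [inducedSubgraph]

/-- The value of a coalition is at most the cover value of its members. -/
theorem gamma_le_sum (hy : IsFractionalCover G w y) (S : Finset V) :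
    gamma G b w S ≤ ∑ i ∈ S, (b i : ℝ) * y i := by
  classical
  obtain ⟨z, hz, hw⟩ := (gamma_isGreatest G b w (S : Set V)).1
  -- Both ends of every edge of `G[S]` lie in `S`, so `y` may be cut off outside `S` and still
  -- cover.
  have hy' : IsFractionalCover (inducedSubgraph G (S : Set V)) w fun i => if i ∈ S then y i else 0 := by
    refine ⟨fun i j hij => ?_, fun i => ?_⟩
    · have h1 : i ∈ S := hij.2.1
      have h2 : j ∈ S := hij.2.2
      simpa [h1, h2] using hy.1 i j hij.1
    · dsimp only
      split_ifs
      · exact hy.2 i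
      · exact le_rfl
  rw [← hw]
  refine (weight_le_cover hz hy').trans (le_of_eq ?_)
  simp

/-- Odd cycles have length at least 3, so the subtracted term is at most `1/3`; it is 0 when `L` or
`β` is `⊤`. -/
theorem factor_bounds {L β : ℕ∞} (hL : 3 ≤ L) (hβ : 1 ≤ β) : 0 < factor L β ∧ factor L β ≤ 1 := by
  have h1 : (3 : ℕ∞) ≤ L * β := by simpa using mul_le_mul' hL hβ
  have h2 : (3 : ℝ≥0∞) ≤ ((L * β : ℕ∞) : ℝ≥0∞) := by exact_mod_cast ENat.toENNReal_le.2 h1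
  have h3 := ENNReal.toReal_mono (by simp) (ENNReal.inv_le_inv.2 h2)
  rw [ENNReal.toReal_inv 3, ENNReal.toReal_ofNat] at h3
  refine ⟨?_, sub_le_self _ ENNReal.toReal_nonneg⟩
  rw [factor]
  linarith

/-- The factor is a lower bound for the fraction that a vertex on a cycle keeps. -/
theorem factor_le {L β : ℕ∞} (hL : 3 ≤ L) (hβ : 1 ≤ β) {l c : ℕ} (hl : L ≤ l) (hc : β ≤ c) :
    factor L β ≤ 1 - 1 / ((l : ℝ) * c) := by
  have h1 : (3 : ℕ∞) ≤ L * β := by simpa using mul_le_mul' hL hβ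
  have h2 : (3 : ℝ≥0∞) ≤ ((L * β : ℕ∞) : ℝ≥0∞) := by exact_mod_cast ENat.toENNReal_le.2 h1
  have h3 : ((L * β : ℕ∞) : ℝ≥0∞) ≤ ((l * c : ℕ) : ℝ≥0∞) := by
    have : L * β ≤ ((l * c : ℕ) : ℕ∞) := by
      push_cast
      exact mul_le_mul' hl hc
    exact_mod_cast ENat.toENNReal_le.2 this
  -- Monotonicity of `toReal` needs the larger inverse to be finite, which `3 ≤ L * β` ensures.
  have h4 := ENNReal.toReal_mono
    (ENNReal.inv_ne_top.2 ((show (0 : ℝ≥0∞) < 3 by norm_num).trans_le h2).ne')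
    (ENNReal.inv_le_inv.2 h3)
  rw [ENNReal.toReal_inv, ENNReal.toReal_natCast] at h4
  rw [factor, one_div]
  rw [Nat.cast_mul] at h4
  linarith

/-- Stated for arbitrary lower bounds `L` and `β` on the lengths and capacities along `𝒞`, so that
both approximation factors are instances. -/
theorem inApproxCore_allocation (hx : IsMaxFractionalBMatching G b w x) (hh : IsHalfIntegral G x)
    (h𝒞 : NonIntegralCycles G x 𝒞) (hy : IsMinFractionalCover G b w y) {L β : ℕ∞} (hL : 3 ≤ L)
    (hβ : 1 ≤ β) (hlen : ∀ C ∈ 𝒞, L ≤ cycleLength C)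
    (hcap : ∀ C ∈ 𝒞, ∀ i ∈ C.verts, β ≤ b i) :
    InApproxCore G b w (factor L β) (allocation b y 𝒞) := by
  obtain ⟨hpos, hle⟩ := factor_bounds hL hβ
  have hby : ∀ i, 0 ≤ (b i : ℝ) * y i := fun i => mul_nonneg (Nat.cast_nonneg _) (hy.1.2 i)
  have hge : ∀ i, factor L β * (b i * y i) ≤ allocation b y 𝒞 i := fun i => by
    rw [allocation]
    split_ifs with h
    · exact mul_le_mul_of_nonneg_right (factor_le hL hβ (hlen _ h.choose_spec.1)
        (hcap _ h.choose_spec.1 i h.choose_spec.2)) (hby i)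
    · exact mul_le_of_le_one_left (hby i) hle
  refine ⟨hpos, hle, fun i => (mul_nonneg hpos.le (hby i)).trans (hge i), ?_, fun S => ?_⟩
  · have hdual := IsMinFractionalCover.weight_eq hx hy
    -- A non-integral edge has a nonzero, hence positive value, so complementary slackness makes it
    -- tight.
    obtain ⟨z, hz, hzw⟩ := exists_bMatching_of_nonIntegralCycles (w := w) (y := y) hx.1 hh h𝒞
      fun e he hi => eq_endSum_of_pos hx.1 hy.1 hdual he
        ((hx.1.2 e he).lt_of_ne' fun h0 => hi ⟨0, by simpa using h0⟩)
    have h1 : weight G w (fun e => (z e : ℝ)) ≤ gamma G b w Set.univ := by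
      refine (gamma_isGreatest G b w Set.univ).2 ?_
      rw [inducedSubgraph_univ]
      exact ⟨z, hz, rfl⟩
    simp only [allocation_eq_sub hx.1 hh h𝒞, Finset.sum_sub_distrib]
    rw [← hdual]
    exact hzw.trans h1
  · refine (mul_le_mul_of_nonneg_left (gamma_le_sum hy.1 S) hpos.le).trans ?_
    rw [Finset.mul_sum]
    exact Finset.sum_le_sum fun i _ => hge i

end BMatchingGame

theorem theorem3p2 {V : Type*} [Fintype V] (G : SimpleGraph V) (b : V → ℕ) (w : Sym2 V → ℝ) :
    -- the first step is possible
    (∃ (x : Sym2 V → ℝ) (y : V → ℝ), BMatchingGame.IsMaxFractionalBMatching G b w x ∧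
      BMatchingGame.IsHalfIntegral G x ∧ BMatchingGame.IsMinFractionalCover G b w y) ∧
    -- every half-integral optimal solution can be modified by alternating operations
    (∀ x₀ : Sym2 V → ℝ, BMatchingGame.IsMaxFractionalBMatching G b w x₀ →
      BMatchingGame.IsHalfIntegral G x₀ →
      ∃ (x : Sym2 V → ℝ) (𝒞 : Set G.Subgraph),
        Relation.ReflTransGen (BMatchingGame.ModifyStep G) x₀ x ∧
        BMatchingGame.IsMaxFractionalBMatching G b w x ∧ BMatchingGame.IsHalfIntegral G x ∧
        BMatchingGame.NonIntegralCycles G x 𝒞) ∧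
    -- for every modified solution and every minimum fractional cover, the resulting allocation
    -- lies in the approximate core, with both factors
    (∀ (x : Sym2 V → ℝ) (𝒞 : Set G.Subgraph) (y : V → ℝ),
      BMatchingGame.IsMaxFractionalBMatching G b w x → BMatchingGame.IsHalfIntegral G x →
      BMatchingGame.NonIntegralCycles G x 𝒞 → BMatchingGame.IsMinFractionalCover G b w y →
      BMatchingGame.InApproxCore G b w
        (BMatchingGame.factor (BMatchingGame.minLength 𝒞) (BMatchingGame.minCapacityOn b 𝒞))
        (BMatchingGame.allocation b y 𝒞) ∧
      ((∀ v, 1 ≤ b v) →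
        BMatchingGame.InApproxCore G b w
          (BMatchingGame.factor (BMatchingGame.minOddCycleLength G) (BMatchingGame.minCapacity b))
          (BMatchingGame.allocation b y 𝒞))) := by
  refine ⟨?_, fun x₀ hx₀ hh => BMatchingGame.exists_modification hx₀ hh,
    fun x 𝒞 y hx hh h𝒞 hy => ⟨?_, fun hb => ?_⟩⟩
  · obtain ⟨x, hx, hh⟩ := BMatchingGame.exists_halfIntegral_max G b w
    obtain ⟨y, hy⟩ := BMatchingGame.exists_minFractionalCover G b w
    exact ⟨x, y, hx, hh, hy⟩
  · refine BMatchingGame.inApproxCore_allocation hx hh h𝒞 hy ?_ ?_ (fun C hC => iInf₂_le C hC)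
      fun C hC i hi => (iInf₂_le C hC).trans (iInf₂_le i hi)
    · exact le_iInf₂ fun C hC => by exact_mod_cast (h𝒞.oddCycle C hC).three_le_cycleLength
    · exact le_iInf₂ fun C hC => le_iInf₂ fun i hi => by
        exact_mod_cast BMatchingGame.one_le_capacity hx.1 hh h𝒞 hC hi
  · refine BMatchingGame.inApproxCore_allocation hx hh h𝒞 hy ?_ ?_
      (fun C hC => iInf₂_le C (h𝒞.oddCycle C hC)) fun C hC i hi => iInf_le _ i
    · exact le_iInf₂ fun C hC => by
        exact_mod_cast BMatchingGame.IsOddCycle.three_le_cycleLength hC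
    · exact le_iInf fun i => by exact_mod_cast hb i
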